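/- Let $N\ge 1$ and $\mathsf s=(s_1,\dots,s_N)\in(0,1]^N$ with $\sum_k s_k<N$. Put $s=\min_k s_k$ (so $s<1$), $L=\{k : s_k=s\}$ and $\alpha=\sum_{k=1}^N 1/s_k$. *Definitions.* All balls $B(x,r)$ are open balls of finite radius. A complete metric space $(X,d)$ is Ahlfors $\beta$-regular ($\beta>0$) if there is $K>0$ with $K^{-1}r^\beta\le\mathcal H^\beta(B(x,r))\le Kr^\beta$ for all $x\in X$ and all finite $r\in(0,\operatorname{diam}X]$. It is a BPI space of dimension $\beta$ if it is Ahlfors $\beta$-regular and there are $C,\theta>0$ such that for all $x,y\in X$ and all finite $r,t\in(0,\operatorname{diam}X]$ there are a closed set $A\subset B(x,r)$ with $\mathcal H^\beta(A)\ge\theta r^\beta$ and a map $f:A\to B(y,t)$ with $C^{-1}r^{-1}d(a,b)\le t^{-1}d(f(a),f(b))\le C\,r^{-1}d(a,b)$ for all $a,b\in A$. If $d$ is a semi-distance on $X$ (a nonnegative symmetric function that vanishes on the diagonal and satisfies the triangle inequality), $(X/d,\overline d)$ is the quotient metric space of $X$ by the relation $d(x,y)=0$. *The semi-distance $d_{\mathcal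 R}$.* Let $l\ge1$ be an integer, $h=2^{-l}$ and $\mu=h^s$, where $l$ is so large that $\mu\le\min\{\tfrac14,\,(1-s)^s,\,\tfrac12(2^{l-1}-1)^{s/2}\}$. Let $\mathcal S\subset\mathbb R\times\mathbb R$ be the set of all pairs $\big(h^{n-1}(m+\tfrac12),\,h^{n-1}(m+\tfrac12)+h^{n+1}\big)$ with $n\ge1$ and $m\in\mathbb Z$, and let $\mathcal R$ be the equivalence relation on $\mathbb R$ given by $x\mathcal R y$ iff $x=y$ or $(x,y)\in\mathcal S$ or $(y,x)\in\mathcal S$. Define $$d_{\mathcal R}(x,y)=\inf\Big\{\sum_{k=0}^n|x_k-y_k|^s : n\ge0,\ x\mathcal R x_0,\ y_k\mathcal R x_{k+1}\ (0\le k<n),\ y_n\mathcal R y\Big\}$$ and, on $\mathbb R^N$, $$d_{\mathsf s,\mathcal R}(x,y)=\sum_{k\in L}d_{\mathcal R}(x_k,y_k)+\sum_{k\notin L}|x_k-y_k|^{s_k}.$$ *Proposition.* The quotient space $([0,1]^N/d_{\mathsf s,\mathcal R},\overline d_{\mathsf s,\mathcal R})$ is a BPI space of dimension $\alpha$. Moreover,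 each of the spaces $([0,1],|\cdot|^{s_k})$ for $k\notin L$ and $([0,1]/d_{\mathcal R},\overline d_{\mathcal R})$ for $k\in L$ is a bounded BPI space of dimension $1/s_k$, and the map sending the class of $(x_1,\dots,x_N)$ to the tuple of the classes of its coordinates is a well-defined isometry of $([0,1]^N/d_{\mathsf s,\mathcal R},\overline d_{\mathsf s,\mathcal R})$ onto the $\ell^1$ product of these spaces. -/

import Mathlib

open MeasureTheory Set
open scoped ENNReal

noncomputable section

/-! ### Ahlfors regular spaces and BPI spaces -/

/-- `(X, d, m)` is Ahlfors regular of dimension `α`: `X` is complete, `α > 0`, and the mass of every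
ball of (finite) radius `r ∈ (0, diam X]` is comparable to `r ^ α`. -/
def IsAhlforsRegular {X : Type*} [MetricSpace X] [MeasurableSpace X]
    (m : Measure X) (α : ℝ) : Prop :=
  CompleteSpace X ∧ 0 < α ∧ ∃ K : ℝ, 0 < K ∧
    ∀ (x : X) (r : ℝ), 0 < r → ENNReal.ofReal r ≤ Metric.ediam (univ : Set X) →
      ENNReal.ofReal (K⁻¹ * r ^ α) ≤ m (Metric.ball x r) ∧
      m (Metric.ball x r) ≤ ENNReal.ofReal (K * r ^ α)

/-- `X` is a BPI space of dimension `α`: it is Ahlfors regular of dimension `α` (for the Hausdorff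
measure `μH[α]`), and for some `C, θ > 0`, any two balls `B(x, r)`, `B(y, t)` with
`r, t ∈ (0, diam X]` admit a closed `A ⊆ B(x, r)` with `μH[α] A ≥ θ r ^ α` and a `C`-biLipschitz map
from `A`, with distance `r⁻¹ d`, to `B(y, t)`, with distance `t⁻¹ d`. -/
def IsBPI (X : Type*) [MetricSpace X] [MeasurableSpace X] [BorelSpace X] (α : ℝ) : Prop :=
  IsAhlforsRegular (μH[α] : Measure X) α ∧
  ∃ C θ : ℝ, 0 < C ∧ 0 < θ ∧
    ∀ (x y : X) (r t : ℝ),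
      0 < r → ENNReal.ofReal r ≤ Metric.ediam (univ : Set X) →
      0 < t → ENNReal.ofReal t ≤ Metric.ediam (univ : Set X) →
      ∃ A : Set X, IsClosed A ∧ A ⊆ Metric.ball x r ∧
        ENNReal.ofReal (θ * r ^ α) ≤ μH[α] A ∧
        ∃ f : A → X, (∀ a : A, f a ∈ Metric.ball y t) ∧
          ∀ a b : A, C⁻¹ * (r⁻¹ * dist a b) ≤ t⁻¹ * dist (f a) (f b) ∧
            t⁻¹ * dist (f a) (f b) ≤ C * (r⁻¹ * dist a b)

/-! ### Semi-distances and the metric space `X/d`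

A semi-distance on `X` is a term of Mathlib's type `PseudoMetric X ℝ`. -/

namespace PseudoMetric

/-- The set `X`, endowed with the semi-distance `d`. -/
def Space {X : Type*} (_ : PseudoMetric X ℝ) : Type _ := X

instance {X : Type*} (d : PseudoMetric X ℝ) : PseudoMetricSpace d.Space where
  dist := fun x y => d x y
  dist_self := d.refl
  dist_comm := d.symm
  dist_triangle := d.triangle

/-- The metric space `(X/d, d̄)`: the quotient of `X` by the relation `d x y = 0`, with the distance
`d̄ (π x) (π y) = d x y`. -/
def QuotSpace {X : Type*} (d : PseudoMetric X ℝ) : Type _ := SeparationQuotient d.Space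

instance {X : Type*} (d : PseudoMetric X ℝ) : MetricSpace d.QuotSpace :=
  inferInstanceAs (MetricSpace (SeparationQuotient d.Space))

instance {X : Type*} (d : PseudoMetric X ℝ) : MeasurableSpace d.QuotSpace := borel _

instance {X : Type*} (d : PseudoMetric X ℝ) : BorelSpace d.QuotSpace := ⟨rfl⟩

/-- The canonical projection `π : X → X/d`. -/
def proj {X : Type*} (d : PseudoMetric X ℝ) (x : X) : d.QuotSpace :=
  SeparationQuotient.mk (X := d.Space) x

theorem dist_proj {X : Type*} (d : PseudoMetric X ℝ) (x y : X) :
    dist (d.proj x) (d.proj y) = d x y := rfl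

theorem proj_eq_proj_iff {X : Type*} (d : PseudoMetric X ℝ) (x y : X) :
    d.proj x = d.proj y ↔ d x y = 0 := by
  rw [← dist_proj, dist_eq_zero]

/-- The restriction of a semi-distance to a subset. -/
def restrict {X : Type*} (d : PseudoMetric X ℝ) (S : Set X) : PseudoMetric S ℝ where
  toFun x y := d x y
  refl' x := d.refl x
  symm' x y := d.symm x y
  triangle' x y z := d.triangle x y z

/-- The semi-distance `∑ k, d_k (x_k, y_k)` on `ℝ ^ N`. -/
def coordSum {N : ℕ} (d : Fin N → PseudoMetric ℝ ℝ) : PseudoMetric (Fin N → ℝ) ℝ where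
  toFun x y := ∑ k, d k (x k) (y k)
  refl' x := by simp
  symm' x y := Finset.sum_congr rfl fun k _ => (d k).symm _ _
  triangle' x y z := by
    rw [← Finset.sum_add_distrib]
    exact Finset.sum_le_sum fun k _ => (d k).triangle _ _ _

end PseudoMetric

/-! ### Quotient semi-distances -/

/-- The lengths `∑_{k=0}^n d(x_k, y_k)` of all itineraries `(x_0, y_0, …, x_n, y_n)` between `x` and
`y`, that is, `x ~ x_0`, `y_k ~ x_{k+1}` for `k < n`, and `y_n ~ y`. Only the values `u k`, `v k` for
`k ≤ n` matter. -/
def itineraryLengths {X : Type*} (d : PseudoMetric X ℝ) (R : Setoid X) (x y : X) : Set ℝ :=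
  {c | ∃ (n : ℕ) (u v : ℕ → X), R x (u 0) ∧ (∀ k < n, R (v k) (u (k + 1))) ∧ R (v n) y ∧
    c = ∑ k ∈ Finset.range (n + 1), d (u k) (v k)}

theorem itineraryLengths_bddBelow {X : Type*} (d : PseudoMetric X ℝ) (R : Setoid X) (x y : X) :
    BddBelow (itineraryLengths d R x y) := by
  refine ⟨0, ?_⟩
  rintro c ⟨n, u, v, -, -, -, rfl⟩
  exact Finset.sum_nonneg fun k _ => d.nonneg _ _

theorem itineraryLengths_nonempty {X : Type*} (d : PseudoMetric X ℝ) (R : Setoid X) (x y : X) :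
    (itineraryLengths d R x y).Nonempty :=
  ⟨_, 0, fun _ => x, fun _ => y, R.refl x, by simp, R.refl y, rfl⟩

theorem itineraryLengths_symm {X : Type*} (d : PseudoMetric X ℝ) (R : Setoid X) {x y : X} {c : ℝ}
    (h : c ∈ itineraryLengths d R x y) : c ∈ itineraryLengths d R y x := by
  obtain ⟨n, u, v, h0, h1, h2, rfl⟩ := h
  refine ⟨n, fun k => v (n - k), fun k => u (n - k), ?_, ?_, ?_, ?_⟩
  · exact R.symm h2
  · intro k hk
    have h := R.symm (h1 (n - (k + 1)) (by omega))
    have e : n - (k + 1) + 1 = n - k := by omega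
    rw [e] at h
    exact h
  · simpa using R.symm h0
  · rw [← Finset.sum_range_reflect (fun k => d (u k) (v k))]
    refine Finset.sum_congr rfl fun k _ => ?_
    rw [d.symm]
    have e : n + 1 - 1 - k = n - k := by omega
    rw [e]

theorem itineraryLengths_add {X : Type*} (d : PseudoMetric X ℝ) (R : Setoid X) {x y z : X}
    {a b : ℝ} (ha : a ∈ itineraryLengths d R x y) (hb : b ∈ itineraryLengths d R y z) :
    a + b ∈ itineraryLengths d R x z := by
  obtain ⟨n, u, v, h0, h1, h2, rfl⟩ := ha
  obtain ⟨n', u', v', h0', h1', h2', rfl⟩ := hb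
  refine ⟨n + 1 + n', fun k => if k ≤ n then u k else u' (k - (n + 1)),
    fun k => if k ≤ n then v k else v' (k - (n + 1)), ?_, ?_, ?_, ?_⟩
  · simpa using h0
  · intro k hk
    rcases lt_trichotomy k n with h | h | h
    · have e1 : k ≤ n := h.le
      have e2 : k + 1 ≤ n := h
      simp only [e1, e2, if_true]
      exact h1 k h
    · subst h
      simp only [le_refl, if_true, Nat.not_succ_le_self, if_false, Nat.sub_self]
      exact R.trans h2 h0'
    · have e1 : ¬ k ≤ n := by omega
      have e2 : ¬ k + 1 ≤ n := by omega
      have e3 : k + 1 - (n + 1) = k - (n + 1) + 1 := by omega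
      simp only [e1, e2, if_false, e3]
      exact h1' _ (by omega)
  · have e1 : ¬ n + 1 + n' ≤ n := by omega
    have e2 : n + 1 + n' - (n + 1) = n' := by omega
    simp only [e1, if_false, e2]
    exact h2'
  · rw [show n + 1 + n' + 1 = (n + 1) + (n' + 1) by omega,
      Finset.sum_range_add _ (n + 1) (n' + 1)]
    refine congrArg₂ (fun p q : ℝ => p + q) (Finset.sum_congr rfl fun k hk => ?_)
      (Finset.sum_congr rfl fun k _ => ?_)
    · have e1 : k ≤ n := by simpa [Nat.lt_succ_iff] using hk
      simp only [e1, if_true]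
    · have e1 : ¬ n + 1 + k ≤ n := by omega
      have e2 : n + 1 + k - (n + 1) = k := by omega
      simp only [e1, if_false, e2]

/-- The quotient semi-distance `d_R` on `X`: the infimum of the lengths of the itineraries. -/
def quotientSemidistance {X : Type*} (d : PseudoMetric X ℝ) (R : Setoid X) : PseudoMetric X ℝ where
  toFun x y := sInf (itineraryLengths d R x y)
  refl' x := by
    refine le_antisymm ?_ ?_
    · refine csInf_le (itineraryLengths_bddBelow d R x x)
        ⟨0, fun _ => x, fun _ => x, R.refl x, by simp, R.refl x, by simp⟩
    · refine Real.sInf_nonneg ?_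
      rintro c ⟨n, u, v, -, -, -, rfl⟩
      exact Finset.sum_nonneg fun k _ => d.nonneg _ _
  symm' x y := by
    congr 1
    ext c
    exact ⟨itineraryLengths_symm d R, itineraryLengths_symm d R⟩
  triangle' x y z := by
    refine le_of_forall_pos_le_add fun ε hε => ?_
    obtain ⟨a, ha, ha'⟩ := exists_lt_of_csInf_lt (itineraryLengths_nonempty d R x y)
      (lt_add_of_pos_right _ (half_pos hε))
    obtain ⟨b, hb, hb'⟩ := exists_lt_of_csInf_lt (itineraryLengths_nonempty d R y z)
      (lt_add_of_pos_right _ (half_pos hε))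
    have := csInf_le (itineraryLengths_bddBelow d R x z) (itineraryLengths_add d R ha hb)
    linarith

/-! ### Snowflakes of the line -/

/-- The snowflaked distance `|x - y| ^ s` on `ℝ`, for `s ∈ (0, 1]`. -/
def snowflake (s : Ioc (0 : ℝ) 1) : PseudoMetric ℝ ℝ where
  toFun x y := |x - y| ^ (s : ℝ)
  refl' x := by simp [Real.zero_rpow s.2.1.ne']
  symm' x y := by rw [abs_sub_comm]
  triangle' x y z :=
    (Real.rpow_le_rpow (abs_nonneg _) (abs_sub_le x y z) s.2.1.le).trans
      (Real.rpow_add_le_add_rpow (abs_nonneg _) (abs_nonneg _) s.2.1.le s.2.2)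

/-! ### The shortcuts -/

/-- The scale `h = 1 / 2 ^ l`. -/
def scale (l : ℕ) : ℝ := 1 / 2 ^ l

/-- The set of all shortcuts, the union over the levels `n ≥ 1` of the sets
`{(h ^ (n-1) (m + 1/2), h ^ (n-1) (m + 1/2) + h ^ (n+1)) : m ∈ ℤ}`. -/
def shortcuts (l : ℕ) : Set (ℝ × ℝ) :=
  {z | ∃ (n : ℕ) (m : ℤ), 1 ≤ n ∧
    z = (scale l ^ (n - 1) * (m + 1 / 2), scale l ^ (n - 1) * (m + 1 / 2) + scale l ^ (n + 1))}

/-- An odd numerator and an exponent of `2` determine each other in a dyadic number. -/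
theorem dyadic_unique {a b : ℤ} {i j : ℕ} (h : ((2 * a + 1 : ℤ) : ℝ) / 2 ^ i = (2 * b + 1 : ℤ) / 2 ^ j) :
    i = j ∧ a = b := by
  have key : ∀ (a b : ℤ) (i j : ℕ), i ≤ j →
      ((2 * a + 1 : ℤ) : ℝ) / 2 ^ i = (2 * b + 1 : ℤ) / 2 ^ j → i = j ∧ a = b := by
    intro a b i j hij h
    obtain ⟨k, rfl⟩ := Nat.exists_eq_add_of_le hij
    rw [div_eq_div_iff (by positivity) (by positivity), pow_add] at h
    have h2 : ((2 * a + 1 : ℤ) : ℝ) * 2 ^ k = (2 * b + 1 : ℤ) := by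
      have : (2 : ℝ) ^ i ≠ 0 := by positivity
      apply mul_right_cancel₀ this
      linarith
    have h3 : (2 * a + 1) * 2 ^ k = 2 * b + 1 := by exact_mod_cast h2
    rcases k with _ | k
    · simp at h3 ⊢
      omega
    · exfalso
      rw [pow_succ] at h3
      have : 2 * ((2 * a + 1) * 2 ^ k) = 2 * b + 1 := by linarith
      omega
  rcases le_total i j with hij | hij
  · exact key a b i j hij h
  · obtain ⟨h1, h2⟩ := key b a j i hij h.symm
    exact ⟨h1.symm, h2.symm⟩

theorem shortcuts_spec {l : ℕ} (hl : 2 ≤ l) {x y : ℝ} (h : (x, y) ∈ shortcuts l) :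
    ∃ (n : ℕ) (a b : ℤ), x = (2 * a + 1 : ℤ) / 2 ^ (l * n + 1) ∧
      y = (2 * b + 1 : ℤ) / 2 ^ (l * (n + 2)) ∧ y = x + 1 / 2 ^ (l * (n + 2)) := by
  obtain ⟨n, m, hn, he⟩ := h
  obtain ⟨n, rfl⟩ := Nat.exists_eq_add_of_le' hn
  obtain ⟨l, rfl⟩ := Nat.exists_eq_add_of_le' hl
  simp only [Prod.mk.injEq, Nat.add_sub_cancel, scale] at he
  obtain ⟨hx, hy⟩ := he
  have hy' : y = x + 1 / 2 ^ ((l + 2) * (n + 2)) := by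
    rw [hy, ← hx, div_pow, one_pow, ← pow_mul]
  have hx' : x = (2 * m + 1 : ℤ) / 2 ^ ((l + 2) * n + 1) := by
    rw [hx, div_pow, one_pow, ← pow_mul, pow_succ]
    push_cast
    field_simp
  refine ⟨n, m, (2 * m + 1) * 2 ^ (2 * l + 2), hx', ?_, hy'⟩
  rw [hy', hx']
  have e : (l + 2) * (n + 2) = ((l + 2) * n + 1) + (2 * l + 3) := by ring
  rw [e, pow_add (2 : ℝ) ((l + 2) * n + 1) (2 * l + 3)]
  push_cast
  field_simp
  ring

/-- The equivalence relation on `ℝ` defined by the shortcuts: `x ~ y` if and only if `x = y` or there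
is a shortcut between `x` and `y`. -/
def shortcutSetoid (l : ℕ) (hl : 2 ≤ l) : Setoid ℝ where
  r x y := x = y ∨ (x, y) ∈ shortcuts l ∨ (y, x) ∈ shortcuts l
  iseqv := by
    have hne : ∀ {n n' : ℕ}, l * n + 1 = l * n' → False := by
      intro n n' h
      have h1 : l ∣ l * n + 1 := h ▸ dvd_mul_right l n'
      have h2 : l ∣ 1 := (Nat.dvd_add_right (dvd_mul_right l n)).1 h1
      have := Nat.le_of_dvd one_pos h2
      omega
    refine ⟨fun x => Or.inl rfl, ?_, ?_⟩
    · rintro x y (h | h | h)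
      · exact Or.inl h.symm
      · exact Or.inr (Or.inr h)
      · exact Or.inr (Or.inl h)
    · rintro x y z (rfl | h | h) (rfl | h' | h')
      · exact Or.inl rfl
      · exact Or.inr (Or.inl h')
      · exact Or.inr (Or.inr h')
      · exact Or.inr (Or.inl h)
      · obtain ⟨n, a, b, -, hy, -⟩ := shortcuts_spec hl h
        obtain ⟨n', a', b', hy', -, -⟩ := shortcuts_spec hl h'
        exact (hne (dyadic_unique (hy'.symm.trans hy)).1).elim
      · obtain ⟨n, a, b, -, hy, hxy⟩ := shortcuts_spec hl h
        obtain ⟨n', a', b', -, hy', hzy⟩ := shortcuts_spec hl h'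
        have e := (dyadic_unique (hy.symm.trans hy')).1
        rw [← e] at hzy
        left
        linarith
      · exact Or.inr (Or.inr h)
      · obtain ⟨n, a, b, hy, -, hxy⟩ := shortcuts_spec hl h
        obtain ⟨n', a', b', hy', -, hzy⟩ := shortcuts_spec hl h'
        have e := (dyadic_unique (hy.symm.trans hy')).1
        have e' : l * (n + 2) = l * (n' + 2) := by
          have : l * n = l * n' := by omega
          rw [mul_add, mul_add, this]
        rw [← e'] at hzy
        left
        linarith
      · obtain ⟨n, a, b, hy, -, -⟩ := shortcuts_spec hl h
        obtain ⟨n', a', b', -, hy', -⟩ := shortcuts_spec hl h'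
        exact (hne (dyadic_unique (hy.symm.trans hy')).1).elim

/-- The requirement that `l` is large enough with respect to `s`: the number `μ = h ^ s` satisfies
`μ ≤ min {1/4, (1-s)^s, (1/2) (2^(l-1) - 1)^(s/2)}`. -/
def LargeEnough (s : Ioc (0 : ℝ) 1) (l : ℕ) : Prop :=
  scale l ^ (s : ℝ) ≤ 1 / 4 ∧
  scale l ^ (s : ℝ) ≤ (1 - (s : ℝ)) ^ (s : ℝ) ∧
  scale l ^ (s : ℝ) ≤ 1 / 2 * ((2 : ℝ) ^ ((l : ℝ) - 1) - 1) ^ ((s : ℝ) / 2)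

theorem LargeEnough.two_le {s : Ioc (0 : ℝ) 1} {l : ℕ} (h : LargeEnough s l) : 2 ≤ l := by
  by_contra hl
  have h1 : (1 / 2 : ℝ) ≤ scale l := by
    have : l = 0 ∨ l = 1 := by omega
    rcases this with rfl | rfl <;> norm_num [scale]
  have h2 : scale l ≤ 1 := by
    have : l = 0 ∨ l = 1 := by omega
    rcases this with rfl | rfl <;> norm_num [scale]
  have h3 : scale l ≤ scale l ^ (s : ℝ) := by
    have := Real.rpow_le_rpow_of_exponent_ge (by linarith) h2 s.2.2
    simpa using this
  have := h.1
  linarith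

/-- The semi-distance `d_R` on `ℝ`: the quotient semi-distance of `|x - y| ^ s` by the equivalence
relation defined by the shortcuts. -/
def shortcutSemidistance (s : Ioc (0 : ℝ) 1) (l : ℕ) (hl : LargeEnough s l) : PseudoMetric ℝ ℝ :=
  quotientSemidistance (snowflake s) (shortcutSetoid l hl.two_le)

/-! ### The semi-distance on `ℝ ^ N` -/

section

variable {N : ℕ} [NeZero N]

/-- The minimum snowflaking factor `min_k s_k`. -/
def minFactor (s : Fin N → Ioc (0 : ℝ) 1) : Ioc (0 : ℝ) 1 :=
  Finset.univ.inf' Finset.univ_nonempty s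

open Classical in
/-- The semi-distance on the `k`-th coordinate: `d_R` if `k` belongs to the minimally snowflaked layer
`L = {k | s_k = min_j s_j}`, and `|x - y| ^ s_k` otherwise. -/
def layerSemidistance (s : Fin N → Ioc (0 : ℝ) 1) (l : ℕ) (hl : LargeEnough (minFactor s) l)
    (k : Fin N) : PseudoMetric ℝ ℝ :=
  if s k = minFactor s then shortcutSemidistance (minFactor s) l hl else snowflake (s k)

/-- The semi-distance `d_{s,R}` on `ℝ ^ N`,
`∑_{k ∈ L} d_R (x_k, y_k) + ∑_{k ∉ L} |x_k - y_k| ^ s_k`. -/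
def cubeSemidistance (s : Fin N → Ioc (0 : ℝ) 1) (l : ℕ) (hl : LargeEnough (minFactor s) l) :
    PseudoMetric (Fin N → ℝ) ℝ :=
  PseudoMetric.coordSum (layerSemidistance s l hl)

/-- The metric space `([0,1] ^ N / d_{s,R}, d̄_{s,R})`. -/
abbrev CubeQuot (s : Fin N → Ioc (0 : ℝ) 1) (l : ℕ) (hl : LargeEnough (minFactor s) l) : Type :=
  ((cubeSemidistance s l hl).restrict (Icc 0 1)).QuotSpace

/-- The `k`-th factor: `([0,1] / d_R, d̄_R)` if `k ∈ L`, and `([0,1], |x - y| ^ s_k)` otherwise. (In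
the latter case the semi-distance is a distance, and the quotient identifies no points.) -/
abbrev FactorQuot (s : Fin N → Ioc (0 : ℝ) 1) (l : ℕ) (hl : LargeEnough (minFactor s) l)
    (k : Fin N) : Type :=
  ((layerSemidistance s l hl k).restrict (Icc 0 1)).QuotSpace

end

end

/-! Every factor carries a semi-distance d ≤ |x - y|^σ for which two estimates suffice
(`IsCoarselySelfSimilar`): a ball of radius r meets [0,1] in Lebesgue measure at most C r^(1/σ), and
the interval [2h, 3h] reappears in every h^n-adic interval, scaled by h^(nσ) up to a constant
factor. Each ball then contains a copy of one fixed model with mass comparable to r^(1/σ). Comparing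
this mass with the Hausdorff measure (mass distribution principle above, packing below) gives
Ahlfors regularity, and following the inverse of one copy by another copy gives the BPI maps
(`HasModelCells.isBPI`). Model cells are stable under ℓ¹ products (`HasModelCells.pi`), and the
semi-distance of the cube is a sum over coordinates, so the cube follows from its factors.

For snowflakes both estimates are immediate. For d_R everything rests on duality
(`le_add_quotientSemidistance`): a test function that is 1-Lipschitz for |x - y|^s and takes equal
values at the two ends of every shortcut is 1-Lipschitz for d_R.

At scale 1 the test function is a Cantor staircase that collapses gaps containing the shortcuts.
With b = 1/h, it is s-Hölder at small scales as soon as b^s ≤ b - 1, which the choice of l ensures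
(`LargeEnough.two_pow_rpow_le`).

At scale h^n the shortcuts of levels at most n have their ends in h^n(ℤ ∪ (ℤ + h)). Distinct points
of this grid are at least `gapBound` times μ^n apart for the semi-distance of the finer levels, so
truncating that semi-distance at this height makes it insensitive to the coarse shortcuts too. This
yields `gapBound_mul_le_shortcutSemidistance_scale` (scaled copies of [2h, 3h]) and
`exists_ball_cover` (volume of balls). -/

noncomputable section

/-! ### A Hölder function that is constant along the shortcuts -/

/-- The number of gaps `[m + 1/2, m + 1/2 + 1/b]` to the left of `z + 1/2`, the last one being
counted partially. -/
def gapCount (b : ℕ) (z : ℝ) : ℝ := ⌊z⌋ + min 1 (b * Int.fract z)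

/-- A piecewise affine map of degree `b - 1` that collapses the intervals
`[m + 1/2, m + 1/2 + 1/b]`. -/
def collapse (b : ℕ) (x : ℝ) : ℝ := b * x - gapCount b (x - 1 / 2)

theorem gapCount_add_intCast (b : ℕ) (z : ℝ) (m : ℤ) :
    gapCount b (z + m) = gapCount b z + m := by
  simp only [gapCount, Int.floor_add_intCast, Int.fract_add_intCast, Int.cast_add]
  ring

theorem floor_le_gapCount (b : ℕ) (z : ℝ) : (⌊z⌋ : ℝ) ≤ gapCount b z := by
  have : 0 ≤ min 1 (b * Int.fract z) :=
    le_min zero_le_one (mul_nonneg (Nat.cast_nonneg _) (Int.fract_nonneg z))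
  unfold gapCount
  linarith

theorem gapCount_le_floor_add_one (b : ℕ) (z : ℝ) : gapCount b z ≤ ⌊z⌋ + 1 := by
  have := min_le_left 1 (b * Int.fract z)
  unfold gapCount
  linarith

theorem gapCount_mono (b : ℕ) : Monotone (gapCount b) := by
  intro x y hxy
  rcases (Int.floor_mono hxy).lt_or_eq with h | h
  · have h1 : (⌊x⌋ : ℝ) + 1 ≤ ⌊y⌋ := by exact_mod_cast h
    linarith [floor_le_gapCount b y, gapCount_le_floor_add_one b x]
  · unfold gapCount
    rw [h]
    have : Int.fract x ≤ Int.fract y := by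
      unfold Int.fract
      rw [h]
      linarith
    gcongr

theorem gapCount_sub_le {b : ℕ} (hb : 1 ≤ b) {x y : ℝ} (hxy : x ≤ y) :
    gapCount b y - gapCount b x ≤ b * (y - x) := by
  have hb' : (1 : ℝ) ≤ b := by exact_mod_cast hb
  rcases (Int.floor_mono hxy).lt_or_eq with h | h
  · have h1 : (⌊x⌋ : ℝ) + 1 ≤ ⌊y⌋ := by exact_mod_cast h
    have hy : gapCount b y ≤ ⌊y⌋ + b * (y - ⌊y⌋) := by
      have := min_le_right 1 (b * Int.fract y)
      rw [Int.fract] at this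
      unfold gapCount Int.fract
      linarith
    have hx : (⌊x⌋ : ℝ) + 1 - b * (⌊x⌋ + 1 - x) ≤ gapCount b x := by
      have : 1 - b * (⌊x⌋ + 1 - x) ≤ min 1 (b * Int.fract x) := by
        refine le_min ?_ ?_
        · nlinarith [Int.lt_floor_add_one x]
        · unfold Int.fract
          nlinarith
      unfold gapCount
      linarith
    nlinarith
  · have hf : Int.fract y = Int.fract x + (y - x) := by
      unfold Int.fract
      rw [h]
      ring
    have : min 1 (b * Int.fract y) ≤ min 1 (b * Int.fract x) + b * (y - x) := by
      rw [hf, min_add, mul_add]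
      exact min_le_min_right _ (by nlinarith)
    unfold gapCount
    rw [h]
    linarith

theorem collapse_mono {b : ℕ} (hb : 1 ≤ b) : Monotone (collapse b) := by
  intro x y hxy
  have := gapCount_sub_le hb (sub_le_sub_right hxy (1 / 2))
  unfold collapse
  linarith

theorem collapse_sub_le (b : ℕ) {x y : ℝ} (hxy : x ≤ y) :
    collapse b y - collapse b x ≤ b * (y - x) := by
  have := gapCount_mono b (sub_le_sub_right hxy (1 / 2))
  unfold collapse
  linarith

theorem collapse_add_intCast (b : ℕ) (x : ℝ) (m : ℤ) :
    collapse b (x + m) = collapse b x + (b - 1) * m := by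
  unfold collapse
  rw [add_sub_right_comm, gapCount_add_intCast]
  ring

theorem abs_collapse_sub_le (b : ℕ) (x : ℝ) : |collapse b x - (b - 1) * x| ≤ 2 := by
  have h1 := floor_le_gapCount b (x - 1 / 2)
  have h2 := gapCount_le_floor_add_one b (x - 1 / 2)
  have h3 := Int.floor_le (x - 1 / 2)
  have h4 := Int.lt_floor_add_one (x - 1 / 2)
  unfold collapse
  rw [abs_le]
  constructor <;> linarith

/-- On a cell `[k / b, (k + 1) / b]`, the map `collapse b` is constant or of slope `b`. -/
theorem collapse_cell {b : ℕ} (hb : 1 ≤ b) (hb2 : Even b) (k : ℤ) :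
    (∃ c : ℝ, ∀ x, (k : ℝ) ≤ b * x → b * x ≤ k + 1 → collapse b x = c) ∨
    ∃ c : ℤ, ∀ x, (k : ℝ) ≤ b * x → b * x ≤ k + 1 → collapse b x = b * x - c := by
  obtain ⟨a, rfl⟩ := hb2
  have ha : 1 ≤ a := by omega
  have haR : (1 : ℝ) ≤ a := by exact_mod_cast ha
  have hpos : (0 : ℤ) < (a + a : ℕ) := by omega
  -- The gaps start at ℤ + 1/2. As b = 2a is even, each gap is exactly one cell, of index a modulo
  -- 2a, so the remainder r vanishes exactly on the gaps.
  obtain ⟨q, r, hr0, hr1, hk⟩ : ∃ q r : ℤ, 0 ≤ r ∧ r < (a + a : ℕ) ∧ k - a = (a + a : ℕ) * q + r :=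
    ⟨(k - a) / (a + a : ℕ), (k - a) % (a + a : ℕ), Int.emod_nonneg _ hpos.ne',
      Int.emod_lt_of_pos _ hpos, (Int.mul_ediv_add_emod _ _).symm⟩
  have hkR : (k : ℝ) = a + (a + a) * q + r := by
    have : ((k - a : ℤ) : ℝ) = (((a + a : ℕ) * q + r : ℤ) : ℝ) := by rw [hk]
    push_cast at this
    linarith
  have hr0' : (0 : ℝ) ≤ r := by exact_mod_cast hr0
  have hr1' : (r : ℝ) + 1 ≤ a + a := by exact_mod_cast hr1
  have key : ∀ x : ℝ, (k : ℝ) ≤ (a + a : ℕ) * x → (a + a : ℕ) * x ≤ k + 1 →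
      gapCount (a + a) (x - 1 / 2) = q + min 1 ((a + a) * x - a - (a + a) * q) := by
    intro x h1 h2
    push_cast at h1 h2
    have hz0 : (q : ℝ) ≤ x - 1 / 2 := by nlinarith
    have hz1 : x - 1 / 2 ≤ q + 1 := by nlinarith
    rcases hz1.lt_or_eq with hz1 | hz1
    · have hf : ⌊x - 1 / 2⌋ = q := Int.floor_eq_iff.2 ⟨hz0, hz1⟩
      unfold gapCount Int.fract
      rw [hf]
      push_cast
      congr 2
      ring
    -- The right end of the last cell of a period: the floor jumps here, but the saturated count
    -- gives the same value.
    · have hx : x = q + 1 + 1 / 2 := by linarith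
      rw [hz1, show (q : ℝ) + 1 = ((q + 1 : ℤ) : ℝ) by push_cast; rfl]
      unfold gapCount
      have h3 : (1 : ℝ) ≤ (a + a) * x - a - (a + a) * q := by
        rw [hx]
        linarith
      rw [Int.floor_intCast, Int.fract_intCast, min_eq_left h3]
      simp
  rcases hr0.eq_or_lt with h | h
  · left
    subst h
    refine ⟨k - q, fun x h1 h2 => ?_⟩
    unfold collapse
    rw [key x h1 h2]
    push_cast at h1 h2 hkR ⊢
    rw [min_eq_right (by linarith)]
    linarith
  · right
    refine ⟨q + 1, fun x h1 h2 => ?_⟩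
    have h' : (1 : ℝ) ≤ r := by exact_mod_cast h
    unfold collapse
    rw [key x h1 h2]
    push_cast at h1 h2 hkR ⊢
    rw [min_eq_left (by linarith)]

/-- Between 0 and 1/2 there is no gap, so the map is plain multiplication by b there. -/
theorem collapse_div {a k : ℕ} (ha : 1 ≤ a) (hk : k ≤ a) :
    collapse (a + a) (k / (a + a : ℕ)) = k := by
  have haR : (1 : ℝ) ≤ a := by exact_mod_cast ha
  have hkR : (k : ℝ) ≤ a := by exact_mod_cast hk
  have hx : ((a + a : ℕ) : ℝ) * (k / (a + a : ℕ)) = k := by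
    rw [mul_div_cancel₀]
    push_cast
    linarith
  unfold collapse
  rw [hx]
  set x : ℝ := k / (a + a : ℕ) with hx'
  push_cast at hx
  have h0 : 0 ≤ x := by positivity
  have h1 : x ≤ 1 / 2 := by nlinarith
  suffices gapCount (a + a) (x - 1 / 2) = 0 by rw [this, sub_zero]
  rcases h1.lt_or_eq with h1 | h1
  · have hf : ⌊x - 1 / 2⌋ = -1 := by
      rw [Int.floor_eq_iff]
      push_cast
      constructor <;> linarith
    unfold gapCount Int.fract
    rw [hf, min_eq_left]
    · push_cast
      ring
    · push_cast
      nlinarith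
  · rw [h1]
    simp [gapCount]

/-! ### The Cantor staircase as a limit of rescaled iterates. -/

/-- The limit of `(collapse b)^[j] x / (b - 1) ^ j`, a monotone function that semiconjugates
`collapse b` to the multiplication by `b - 1`. -/
def cantorStair (b : ℕ) (x : ℝ) : ℝ :=
  Filter.limUnder Filter.atTop fun j : ℕ => (collapse b)^[j] x / ((b : ℝ) - 1) ^ j

/-- `collapse b` stays within distance 2 of multiplication by b - 1, so consecutive terms differ by
a geometrically decaying amount. -/
theorem tendsto_cantorStair {b : ℕ} (hb : 3 ≤ b) (x : ℝ) :
    Filter.Tendsto (fun j : ℕ => (collapse b)^[j] x / ((b : ℝ) - 1) ^ j) Filter.atTop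
      (nhds (cantorStair b x)) := by
  have hb' : (3 : ℝ) ≤ b := by exact_mod_cast hb
  refine CauchySeq.tendsto_limUnder (cauchySeq_of_le_geometric (1 / ((b : ℝ) - 1))
    (2 / ((b : ℝ) - 1)) ?_ fun j => ?_)
  · rw [div_lt_one] <;> linarith
  · have h0 : (0 : ℝ) < (b : ℝ) - 1 := by linarith
    rw [dist_comm, Real.dist_eq, Function.iterate_succ_apply', pow_succ]
    set y := (collapse b)^[j] x
    have e : collapse b y / (((b : ℝ) - 1) ^ j * ((b : ℝ) - 1)) - y / ((b : ℝ) - 1) ^ j =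
        (collapse b y - (b - 1) * y) / (((b : ℝ) - 1) ^ j * ((b : ℝ) - 1)) := by
      field_simp
    rw [e, abs_div, abs_of_pos (a := ((b : ℝ) - 1) ^ j * ((b : ℝ) - 1)) (by positivity), one_div,
      inv_pow, ← div_eq_mul_inv, div_div, mul_comm (((b : ℝ) - 1) ^ j)]
    gcongr
    exact abs_collapse_sub_le b y

theorem cantorStair_collapse {b : ℕ} (hb : 3 ≤ b) (x : ℝ) :
    cantorStair b (collapse b x) = (b - 1) * cantorStair b x := by
  have hb' : (3 : ℝ) ≤ b := by exact_mod_cast hb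
  have h0 : (0 : ℝ) < (b : ℝ) - 1 := by linarith
  have h := ((tendsto_cantorStair hb x).comp (Filter.tendsto_add_atTop_nat 1)).const_mul
    ((b : ℝ) - 1)
  refine tendsto_nhds_unique (tendsto_cantorStair hb _) (h.congr fun j => ?_)
  simp only [Function.comp_apply, Function.iterate_succ_apply, pow_succ]
  field_simp

theorem cantorStair_mono {b : ℕ} (hb : 3 ≤ b) : Monotone (cantorStair b) := by
  have hb' : (3 : ℝ) ≤ b := by exact_mod_cast hb
  have h0 : (0 : ℝ) < (b : ℝ) - 1 := by linarith
  intro x y hxy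
  refine le_of_tendsto_of_tendsto' (tendsto_cantorStair hb x) (tendsto_cantorStair hb y)
    fun j => ?_
  have := (collapse_mono (by omega : 1 ≤ b)).iterate j hxy
  gcongr

theorem collapse_iterate_add_intCast {b : ℕ} (x : ℝ) (m : ℤ) (j : ℕ) :
    (collapse b)^[j] (x + m) = (collapse b)^[j] x + (b - 1) ^ j * m := by
  induction j with
  | zero => simp
  | succ j ih =>
    rw [Function.iterate_succ_apply', Function.iterate_succ_apply', ih,
      show ((b : ℝ) - 1) ^ j * m = (((b : ℤ) - 1) ^ j * m : ℤ) by push_cast; ring,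
      collapse_add_intCast]
    push_cast
    ring

theorem cantorStair_add_intCast {b : ℕ} (hb : 3 ≤ b) (x : ℝ) (m : ℤ) :
    cantorStair b (x + m) = cantorStair b x + m := by
  have hb' : (3 : ℝ) ≤ b := by exact_mod_cast hb
  have h0 : (0 : ℝ) < (b : ℝ) - 1 := by linarith
  refine tendsto_nhds_unique (tendsto_cantorStair hb _)
    (((tendsto_cantorStair hb x).add_const (m : ℝ)).congr fun j => ?_)
  rw [collapse_iterate_add_intCast]
  field_simp

theorem cantorStair_zero {a : ℕ} (ha : 2 ≤ a) : cantorStair (a + a) 0 = 0 := by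
  have h := collapse_div (k := 0) (by omega : 1 ≤ a) (by omega)
  have h1 := cantorStair_collapse (by omega : 3 ≤ a + a) 0
  simp only [Nat.cast_zero, zero_div] at h
  rw [h] at h1
  have ha' : (2 : ℝ) ≤ a := by exact_mod_cast ha
  push_cast at h1
  nlinarith

theorem cantorStair_intCast {a : ℕ} (ha : 2 ≤ a) (m : ℤ) : cantorStair (a + a) m = m := by
  have h := cantorStair_add_intCast (by omega : 3 ≤ a + a) 0 m
  simpa [cantorStair_zero ha] using h

theorem cantorStair_div {a k : ℕ} (ha : 2 ≤ a) (hk : k ≤ a) :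
    cantorStair (a + a) (k / (a + a : ℕ)) = k / ((a + a : ℕ) - 1) := by
  have ha' : (2 : ℝ) ≤ a := by exact_mod_cast ha
  have h1 := cantorStair_collapse (by omega : 3 ≤ a + a) (k / (a + a : ℕ))
  rw [collapse_div (by omega) hk] at h1
  have h2 := cantorStair_intCast ha k
  rw [Int.cast_natCast] at h2
  rw [h2] at h1
  rw [eq_div_iff (by push_cast; linarith), mul_comm]
  exact h1.symm

theorem collapse_iterate_sub_le {b : ℕ} (hb : 1 ≤ b) {x y : ℝ} (hxy : x ≤ y) (n : ℕ) :
    (collapse b)^[n] y - (collapse b)^[n] x ≤ b ^ n * (y - x) := by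
  induction n with
  | zero => simp
  | succ n ih =>
    rw [Function.iterate_succ_apply', Function.iterate_succ_apply']
    refine (collapse_sub_le b ((collapse_mono hb).iterate n hxy)).trans ?_
    rw [pow_succ', mul_assoc]
    gcongr

theorem cantorStair_iterate {b : ℕ} (hb : 3 ≤ b) (x : ℝ) (n : ℕ) :
    cantorStair b ((collapse b)^[n] x) = (b - 1) ^ n * cantorStair b x := by
  induction n with
  | zero => simp
  | succ n ih =>
    rw [Function.iterate_succ_apply', cantorStair_collapse hb, ih]
    ring

/-- After n iterations the two points are at most 1 apart, hence so are their values under the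
staircase, which has degree one; the semiconjugacy divides this by (b - 1)^n. -/
theorem cantorStair_sub_le {b : ℕ} (hb : 3 ≤ b) {x y : ℝ} (hxy : x ≤ y) (n : ℕ)
    (h : b ^ n * (y - x) ≤ 1) : cantorStair b y - cantorStair b x ≤ (1 / ((b : ℝ) - 1)) ^ n := by
  have hb' : (3 : ℝ) ≤ b := by exact_mod_cast hb
  have h0 : (0 : ℝ) < (b : ℝ) - 1 := by linarith
  have h1 := (collapse_iterate_sub_le (by omega) hxy n).trans h
  have h2 := cantorStair_mono hb (show (collapse b)^[n] y ≤ (collapse b)^[n] x + (1 : ℤ) by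
    push_cast; linarith)
  rw [cantorStair_add_intCast hb, cantorStair_iterate hb, cantorStair_iterate hb] at h2
  push_cast at h2
  rw [one_div, inv_pow, ← one_div, le_div_iff₀ (by positivity)]
  linarith

/-- `cantorStair b` is Hölder continuous at scales below `1`. -/
theorem min_cantorStair_le {b : ℕ} (hb : 3 ≤ b) {s : ℝ} (hs : 0 < s) (hbs : (b : ℝ) ^ s ≤ b - 1)
    (x y : ℝ) : min 1 |cantorStair b x - cantorStair b y| ≤ b ^ s * |x - y| ^ s := by
  wlog hxy : x ≤ y generalizing x y
  · rw [abs_sub_comm, abs_sub_comm x]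
    exact this y x (le_of_not_ge hxy)
  have hb' : (3 : ℝ) ≤ b := by exact_mod_cast hb
  have h0 : (0 : ℝ) < (b : ℝ) - 1 := by linarith
  have hbs1 : (1 : ℝ) ≤ b ^ s := Real.one_le_rpow (by linarith) hs.le
  rcases hxy.eq_or_lt with rfl | hlt
  · simp [Real.zero_rpow hs.ne']
  rw [abs_sub_comm, abs_sub_comm x, abs_of_nonneg (sub_nonneg.2 (cantorStair_mono hb hxy)),
    abs_of_pos (sub_pos.2 hlt)]
  -- The staircase grows linearly at large distances, faster than |x - y|^s; this is why the left
  -- side is truncated at 1.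
  rcases le_total 1 (y - x) with h1 | h1
  · exact (min_le_left _ _).trans (one_le_mul_of_one_le_of_one_le hbs1
      (Real.one_le_rpow h1 hs.le))
  -- The scale b^-(n+1) < y - x ≤ b^-n; being off by one power of b costs the factor b^s.
  obtain ⟨n, hn1, hn2⟩ := exists_nat_pow_near_of_lt_one (sub_pos.2 hlt) h1
    (by positivity : (0 : ℝ) < 1 / b) (by rw [div_lt_one] <;> linarith)
  refine (min_le_right _ _).trans ((cantorStair_sub_le hb hxy n ?_).trans ?_)
  · rw [one_div, inv_pow, ← one_div, le_div_iff₀ (by positivity)] at hn2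
    linarith
  · have h2 : (1 / ((b : ℝ) - 1)) ^ n ≤ (1 / (b : ℝ) ^ s) ^ n := by
      gcongr
    refine h2.trans ?_
    have h3 : ((1 / (b : ℝ)) ^ (n + 1)) ^ s ≤ (y - x) ^ s :=
      Real.rpow_le_rpow (by positivity) hn1.le hs.le
    refine le_trans (le_of_eq ?_) (mul_le_mul_of_nonneg_left h3 (by positivity))
    rw [← Real.rpow_pow_comm (by positivity), Real.div_rpow zero_le_one (by positivity),
      Real.one_rpow, pow_succ]
    have : (0 : ℝ) < b ^ s := by positivity
    field_simp

/-! ### Lower bounds for quotient semi-distances -/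

/-- Along an itinerary f is unchanged by the jumps and rises by at most d on each leg. All lower
bounds for d_R are obtained by choosing f. -/
theorem le_add_quotientSemidistance {X : Type*} (d : PseudoMetric X ℝ) (R : Setoid X) {f : X → ℝ}
    (hf : ∀ x y, f y ≤ f x + d x y) (hR : ∀ x y, R x y → f x = f y) (x y : X) :
    f y ≤ f x + quotientSemidistance d R x y := by
  rw [← sub_le_iff_le_add']
  refine le_csInf (itineraryLengths_nonempty d R x y) ?_
  rintro c ⟨n, u, v, h0, h1, h2, rfl⟩
  have key : ∀ k ≤ n, f (v k) ≤ f x + ∑ i ∈ Finset.range (k + 1), d (u i) (v i) := by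
    intro k hk
    induction k with
    | zero => simpa [hR _ _ h0] using hf (u 0) (v 0)
    | succ k ih =>
      rw [Finset.sum_range_succ]
      have := hf (u (k + 1)) (v (k + 1))
      rw [← hR _ _ (h1 k hk)] at this
      linarith [ih (by omega)]
  rw [← hR _ _ h2]
  linarith [key n le_rfl]

theorem quotientSemidistance_le {X : Type*} (d : PseudoMetric X ℝ) (R : Setoid X) (x y : X) :
    quotientSemidistance d R x y ≤ d x y :=
  csInf_le (itineraryLengths_bddBelow d R x y)
    ⟨0, fun _ => x, fun _ => y, R.refl x, by simp, R.refl y, by simp⟩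

theorem quotientSemidistance_eq_zero {X : Type*} (d : PseudoMetric X ℝ) (R : Setoid X) {x y : X}
    (h : R x y) : quotientSemidistance d R x y = 0 := by
  refine le_antisymm (csInf_le (itineraryLengths_bddBelow d R x y)
    ⟨0, fun _ => y, fun _ => y, h, by simp, R.refl y, ?_⟩) (PseudoMetric.nonneg _ _ _)
  simp

/-! ### Shortcuts by level -/

theorem scale_pos (l : ℕ) : 0 < scale l := by
  unfold scale
  positivity

theorem scale_mul (l : ℕ) : scale l * 2 ^ l = 1 := by
  unfold scale
  field_simp

theorem scale_pow_mul (l n : ℕ) : scale l ^ n * ((2 : ℝ) ^ l) ^ n = 1 := by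
  rw [← mul_pow, scale_mul, one_pow]

/-- `(p, q)` is a shortcut of level `n + 1`. -/
def IsShortcut (l n : ℕ) (p q : ℝ) : Prop :=
  ∃ m : ℤ, p = scale l ^ n * (m + 1 / 2) ∧ q = p + scale l ^ (n + 2)

theorem mem_shortcuts_iff {l : ℕ} {p q : ℝ} :
    (p, q) ∈ shortcuts l ↔ ∃ n, IsShortcut l n p q := by
  constructor
  · rintro ⟨n, m, hn, he⟩
    obtain ⟨n, rfl⟩ := Nat.exists_eq_add_of_le' hn
    simp only [Prod.mk.injEq, Nat.add_sub_cancel] at he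
    exact ⟨n, m, he.1, by rw [he.2, he.1]⟩
  · rintro ⟨n, m, rfl, rfl⟩
    exact ⟨n + 1, m, by omega, by simp⟩

namespace IsShortcut

variable {l n : ℕ} {p q : ℝ}

theorem mul_scale_pow (h : IsShortcut l n p q) (k : ℕ) :
    IsShortcut l (n + k) (scale l ^ k * p) (scale l ^ k * q) := by
  obtain ⟨m, rfl, rfl⟩ := h
  exact ⟨m, by ring, by ring⟩

theorem mul_two_pow {k : ℕ} (h : IsShortcut l (n + k) p q) :
    IsShortcut l n ((2 ^ l) ^ k * p) ((2 ^ l) ^ k * q) := by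
  obtain ⟨m, rfl, rfl⟩ := h
  have e := scale_pow_mul l k
  refine ⟨m, ?_, ?_⟩
  · linear_combination scale l ^ n * (m + 1 / 2) * e
  · linear_combination scale l ^ (n + 2) * e

theorem add_intCast (h : IsShortcut l n p q) (k : ℤ) : IsShortcut l n (p + k) (q + k) := by
  obtain ⟨m, rfl, rfl⟩ := h
  have e := scale_pow_mul l n
  refine ⟨m + (2 ^ l) ^ n * k, ?_, by ring⟩
  push_cast
  linear_combination -(k : ℝ) * e

theorem sub_intCast (h : IsShortcut l n p q) (k : ℤ) : IsShortcut l n (p - k) (q - k) := by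
  simpa [sub_eq_add_neg] using h.add_intCast (-k)

end IsShortcut

/-- The set `ℤ ∪ (ℤ + h)`, that contains the endpoints of the shortcuts of levels `≤ 0`. -/
def coarseGrid (l : ℕ) : Set ℝ := {x | ∃ k : ℤ, x = k ∨ x = k + scale l}

/-- Multiplication by b^n sends p to b^(n-i)(m + 1/2), an integer since b is even, and the length of
the shortcut to b^(n-i-2), which is h for i = n - 1 and an integer otherwise. -/
theorem IsShortcut.mem_coarseGrid {l i n : ℕ} {p q : ℝ} (hl : 1 ≤ l) (h : IsShortcut l i p q)
    (hi : i < n) :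
    (2 ^ l) ^ n * p ∈ coarseGrid l ∧ (2 ^ l) ^ n * q ∈ coarseGrid l := by
  obtain ⟨m, rfl, rfl⟩ := h
  obtain ⟨j, rfl⟩ := Nat.exists_eq_add_of_lt hi
  obtain ⟨l, rfl⟩ := Nat.exists_eq_add_of_le' hl
  have e := scale_pow_mul (l + 1) i
  have e1 := scale_mul (l + 1)
  have hp : ((2 : ℝ) ^ (l + 1)) ^ (i + j + 1) * (scale (l + 1) ^ i * (m + 1 / 2)) =
      ((2 ^ (l + 1)) ^ j * 2 ^ l * (2 * m + 1) : ℤ) := by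
    push_cast
    linear_combination ((2 : ℝ) ^ (l + 1)) ^ (j + 1) * (m + 1 / 2) * e
  refine ⟨⟨_, Or.inl hp⟩, ?_⟩
  rw [mul_add, hp]
  rcases j with _ | j
  · refine ⟨_, Or.inr (congrArg₂ _ rfl ?_)⟩
    linear_combination scale (l + 1) ^ 2 * 2 ^ (l + 1) * e + scale (l + 1) * e1
  · refine ⟨((2 ^ (l + 1)) ^ (j + 1) * 2 ^ l * (2 * m + 1) : ℤ) + (2 ^ (l + 1)) ^ j, Or.inl ?_⟩
    push_cast
    rw [add_right_inj]
    linear_combination scale (l + 1) ^ 2 * ((2 : ℝ) ^ (l + 1)) ^ (j + 2) * e +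
      ((2 : ℝ) ^ (l + 1)) ^ j * (scale (l + 1) * 2 ^ (l + 1) + 1) * e1

theorem shortcuts_right_unique {l : ℕ} (hl : 2 ≤ l) {p q q' : ℝ} (h : (p, q) ∈ shortcuts l)
    (h' : (p, q') ∈ shortcuts l) : q = q' := by
  obtain ⟨n, a, b, hx, -, hy⟩ := shortcuts_spec hl h
  obtain ⟨n', a', b', hx', -, hy'⟩ := shortcuts_spec hl h'
  have e := (dyadic_unique (hx.symm.trans hx')).1
  have e' : l * (n + 2) = l * (n' + 2) := by
    have : l * n = l * n' := by omega
    rw [mul_add, mul_add, this]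
  rw [hy, hy', e']

theorem shortcuts_left_unique {l : ℕ} (hl : 2 ≤ l) {p p' q : ℝ} (h : (p, q) ∈ shortcuts l)
    (h' : (p', q) ∈ shortcuts l) : p = p' := by
  obtain ⟨n, a, b, -, hx, hy⟩ := shortcuts_spec hl h
  obtain ⟨n', a', b', -, hx', hy'⟩ := shortcuts_spec hl h'
  rw [← (dyadic_unique (hx.symm.trans hx')).1] at hy'
  linarith

/-- In lowest terms the exponent of 2 in the denominator is 1 modulo l at a left end and 0 modulo l
at a right end. -/
theorem shortcuts_not_chain {l : ℕ} (hl : 2 ≤ l) {p q r : ℝ} (h : (p, q) ∈ shortcuts l)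
    (h' : (q, r) ∈ shortcuts l) : False := by
  obtain ⟨n, a, b, -, hy, -⟩ := shortcuts_spec hl h
  obtain ⟨n', a', b', hy', -, -⟩ := shortcuts_spec hl h'
  have h := (dyadic_unique (hy'.symm.trans hy)).1
  have h1 : l ∣ l * n' + 1 := h ▸ dvd_mul_right l (n + 2)
  have h2 : l ∣ 1 := (Nat.dvd_add_right (dvd_mul_right l n')).1 h1
  have := Nat.le_of_dvd one_pos h2
  omega

/-- A shortcut of level 1 lies in a gap, and its length h² is the part of the gap that `collapse`
forgets. A finer shortcut lies in a single cell, on which `collapse` is constant or carries it to a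
shortcut one level coarser. -/
theorem cantorStair_eq_of_isShortcut {l : ℕ} (hl : 2 ≤ l) {n : ℕ} {p q : ℝ}
    (h : IsShortcut l n p q) : cantorStair (2 ^ l) p = cantorStair (2 ^ l) q := by
  have h4 : 4 ≤ 2 ^ l := by simpa using Nat.pow_le_pow_right (n := 2) (by norm_num) hl
  have h4' : (4 : ℝ) ≤ 2 ^ l := by exact_mod_cast h4
  have hc : ((2 ^ l : ℕ) : ℝ) = 2 ^ l := by push_cast; rfl
  have hinj : ∀ {x y : ℝ}, cantorStair (2 ^ l) (collapse (2 ^ l) x) =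
      cantorStair (2 ^ l) (collapse (2 ^ l) y) → cantorStair (2 ^ l) x = cantorStair (2 ^ l) y := by
    intro x y hxy
    rw [cantorStair_collapse (by omega), cantorStair_collapse (by omega), hc] at hxy
    exact mul_left_cancel₀ (by linarith) hxy
  have hs0 := scale_pos l
  have hs1 : scale l ≤ 1 / 4 := by
    have := scale_mul l
    nlinarith
  induction n generalizing p q with
  | zero =>
    obtain ⟨m, rfl, rfl⟩ := h
    refine hinj (congrArg _ ?_)
    have e := scale_mul l
    have h1 : gapCount (2 ^ l) (scale l ^ 0 * (m + 1 / 2) - 1 / 2) = m := by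
      simp [gapCount]
    have h2 : gapCount (2 ^ l) (scale l ^ 0 * (m + 1 / 2) + scale l ^ (0 + 2) - 1 / 2) =
        m + scale l := by
      rw [show scale l ^ 0 * ((m : ℝ) + 1 / 2) + scale l ^ (0 + 2) - 1 / 2 =
        scale l ^ 2 + m by ring, gapCount_add_intCast]
      unfold gapCount
      rw [Int.floor_eq_zero_iff.2 ⟨by positivity, by nlinarith⟩,
        Int.fract_eq_self.2 ⟨by positivity, by nlinarith⟩, hc,
        show (2 : ℝ) ^ l * scale l ^ 2 = scale l by linear_combination scale l * e,
        min_eq_right (by linarith)]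
      push_cast
      ring
    unfold collapse
    rw [h1, h2, hc]
    linear_combination -scale l * e
  | succ n ih =>
    have hsc := h.mul_two_pow (n := n) (k := 1)
    rw [pow_one] at hsc
    have h1 := Int.floor_le ((2 : ℝ) ^ l * p)
    have h2 := Int.lt_floor_add_one ((2 : ℝ) ^ l * p)
    set k := ⌊(2 : ℝ) ^ l * p⌋
    have hpq : (2 : ℝ) ^ l * p ≤ 2 ^ l * q := by
      obtain ⟨m, -, hq⟩ := h
      rw [hq]
      have : 0 < scale l ^ (n + 1 + 2) := by positivity
      nlinarith
    -- The rescaled left end lies in h^n(ℤ + 1/2) and the cell boundary k + 1 in h^n ℤ, so they are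
    -- at least h^n/2 apart, more than the length h^(n+2).
    have hq : (2 : ℝ) ^ l * q ≤ k + 1 := by
      obtain ⟨m, hm, hq⟩ := hsc
      rw [hq]
      have e := scale_pow_mul l n
      have hpn : (0 : ℝ) < (2 ^ l) ^ n := by positivity
      have h3 : ((2 * m + 1 : ℤ) : ℝ) < ((2 * ((2 ^ l) ^ n * (k + 1)) : ℤ) : ℝ) := by
        push_cast
        rw [hm] at h2
        have := mul_lt_mul_of_pos_left h2 hpn
        have e' : ((2 : ℝ) ^ l) ^ n * (scale l ^ n * (m + 1 / 2)) = m + 1 / 2 := by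
          linear_combination (m + 1 / 2 : ℝ) * e
        linarith
      have h4 : 2 * m + 2 ≤ 2 * ((2 ^ l) ^ n * (k + 1)) := by
        have : 2 * m + 1 + 1 ≤ 2 * ((2 ^ l) ^ n * (k + 1)) := Int.cast_lt.1 h3
        linarith
      have h5 : (2 * m + 2 : ℝ) ≤ 2 * ((2 ^ l) ^ n * (k + 1)) := by exact_mod_cast h4
      have h6 := mul_le_mul_of_nonneg_left h5 (pow_pos hs0 n).le
      have h7 : scale l ^ n * (2 * (((2 : ℝ) ^ l) ^ n * (k + 1))) = 2 * (k + 1) := by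
        linear_combination 2 * (k + 1 : ℝ) * e
      have h8 : scale l ^ (n + 2) ≤ scale l ^ n * (1 / 2) := by
        rw [pow_add]
        exact mul_le_mul_of_nonneg_left (by nlinarith) (pow_pos hs0 n).le
      rw [hm]
      linarith
    rcases collapse_cell (b := 2 ^ l) (by omega) (Nat.even_pow.2 ⟨even_two, by omega⟩) k with
      ⟨c, hcell⟩ | ⟨c, hcell⟩
    · rw [hc] at hcell
      exact hinj (by rw [hcell p h1 h2.le, hcell q (h1.trans hpq) hq])
    · rw [hc] at hcell
      refine hinj ?_
      rw [hcell p h1 h2.le, hcell q (h1.trans hpq) hq]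
      exact ih (hsc.sub_intCast c)

/-! ### The parameters -/

namespace LargeEnough

variable {s : Ioc (0 : ℝ) 1} {l : ℕ}

theorem rpow_scale_pos : 0 < scale l ^ (s : ℝ) := Real.rpow_pos_of_pos (scale_pos l) _

theorem lt_one (hl : LargeEnough s l) : (s : ℝ) < 1 := by
  refine lt_of_le_of_ne s.2.2 fun h => ?_
  have h1 := hl.2.1
  have h2 := rpow_scale_pos (s := s) (l := l)
  rw [h] at h1 h2
  norm_num at h1 h2
  linarith

theorem three_le (hl : LargeEnough s l) : 3 ≤ l := by
  have h2 := hl.two_le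
  by_contra h
  obtain rfl : l = 2 := by omega
  have h1 : scale 2 = 1 / 4 := by norm_num [scale]
  have h3 := hl.1
  rw [h1] at h3
  have h4 := Real.rpow_lt_rpow_of_exponent_gt (by norm_num : (0 : ℝ) < 1 / 4) (by norm_num) hl.lt_one
  rw [Real.rpow_one] at h4
  linarith

/-- Since s ≤ 1 - h, it suffices that b^(1-h) ≤ b - 1, which for b = 1/h reads h^h ≤ 1 - h, that is,
h ≤ (1 - h)^(1/h). -/
theorem two_pow_rpow_le (hl : LargeEnough s l) : ((2 : ℝ) ^ l) ^ (s : ℝ) ≤ 2 ^ l - 1 := by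
  have h0 := scale_pos l
  have hs1 : scale l ≤ 1 - s :=
    (Real.rpow_le_rpow_iff h0.le (by linarith [hl.lt_one]) s.2.1).1 hl.2.1
  have hb : (1 : ℝ) ≤ 2 ^ l := one_le_pow₀ (by norm_num)
  have hb0 : (0 : ℝ) < 2 ^ l := by positivity
  have e := scale_mul l
  have hs4 : scale l ≤ 1 / 4 := by
    have : (2 : ℝ) ^ 2 ≤ 2 ^ l := pow_le_pow_right₀ (by norm_num) hl.two_le
    nlinarith
  -- Bernoulli with exponent b/2 = 1/(2h) gives at least 1/2; squaring gives 1/4 ≥ h.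
  have hbern : scale l ≤ (1 - scale l) ^ (2 ^ l : ℕ) := by
    obtain ⟨k, rfl⟩ := Nat.exists_eq_add_of_le' (by linarith [hl.two_le] : 1 ≤ l)
    have h1 := one_add_mul_le_pow (by linarith : (-2 : ℝ) ≤ -scale (k + 1)) (2 ^ k)
    have h2 : (1 / 2 : ℝ) ≤ (1 - scale (k + 1)) ^ (2 ^ k) := by
      refine le_trans (le_of_eq ?_) h1
      push_cast
      linear_combination (1 / 2 : ℝ) * e
    calc scale (k + 1) ≤ (1 / 2) ^ 2 := by linarith
      _ ≤ ((1 - scale (k + 1)) ^ (2 ^ k)) ^ 2 := by gcongr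
      _ = (1 - scale (k + 1)) ^ (2 ^ (k + 1) : ℕ) := by rw [← pow_mul, pow_succ]
  have h1 : scale l ^ scale l ≤ 1 - scale l := by
    have h2 := Real.rpow_le_rpow h0.le hbern h0.le
    rw [← Real.rpow_natCast (1 - scale l), ← Real.rpow_mul (by linarith)] at h2
    push_cast at h2
    rwa [mul_comm, e, Real.rpow_one] at h2
  have h3 : (2 : ℝ) ^ l = (scale l)⁻¹ := by
    exact eq_inv_of_mul_eq_one_right e
  calc ((2 : ℝ) ^ l) ^ (s : ℝ) ≤ (2 ^ l) ^ (1 - scale l) :=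
        Real.rpow_le_rpow_of_exponent_le hb (by linarith)
    _ = 2 ^ l * scale l ^ scale l := by
        rw [Real.rpow_sub hb0, Real.rpow_one, h3, Real.inv_rpow h0.le, div_eq_mul_inv, inv_inv]
    _ ≤ 2 ^ l * (1 - scale l) := by gcongr
    _ = 2 ^ l - 1 := by linear_combination -e

end LargeEnough

/-! ### Estimates of the semi-distance of the shortcuts -/

/-- A semi-distance on the line that, up to a factor `C`, is scaled by `h ^ σ` by the similarities
`t ↦ h ^ n (m + t)`, on the interval `[2h, 3h]`, and whose balls have the measure of a distance of
dimension `1 / σ`. -/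
structure IsCoarselySelfSimilar (d : PseudoMetric ℝ ℝ) (h σ C : ℝ) : Prop where
  le_rpow : ∀ x y, d x y ≤ |x - y| ^ σ
  volume_le : ∀ x r, 0 < r →
    volume {y | y ∈ Icc (0 : ℝ) 1 ∧ d x y < r} ≤ ENNReal.ofReal (C * r ^ (1 / σ))
  le_scale : ∀ (n : ℕ) (m : ℤ), ∀ t ∈ Icc (2 * h) (3 * h), ∀ t' ∈ Icc (2 * h) (3 * h),
    (h ^ σ) ^ n * d t t' ≤ C * d (h ^ n * (m + t)) (h ^ n * (m + t'))
  scale_le : ∀ (n : ℕ) (m : ℤ) (t t' : ℝ),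
    d (h ^ n * (m + t)) (h ^ n * (m + t')) ≤ (h ^ σ) ^ n * d t t'

theorem abs_pow_mul_rpow {h : ℝ} (hh : 0 < h) (n : ℕ) (x σ : ℝ) :
    |h ^ n * x| ^ σ = (h ^ σ) ^ n * |x| ^ σ := by
  rw [abs_mul, abs_of_pos (pow_pos hh n), Real.mul_rpow (by positivity) (abs_nonneg _),
    Real.rpow_pow_comm hh.le]

theorem snowflake_apply (s : Ioc (0 : ℝ) 1) (x y : ℝ) : snowflake s x y = |x - y| ^ (s : ℝ) := rfl

theorem snowflake_isCoarselySelfSimilar (s : Ioc (0 : ℝ) 1) {h : ℝ} (hh : 0 < h) :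
    IsCoarselySelfSimilar (snowflake s) h s 2 := by
  have hscale : ∀ (n : ℕ) (m : ℤ) (t t' : ℝ),
      snowflake s (h ^ n * (m + t)) (h ^ n * (m + t')) = (h ^ (s : ℝ)) ^ n * snowflake s t t' := by
    intro n m t t'
    rw [snowflake_apply, snowflake_apply, ← abs_pow_mul_rpow hh]
    congr 2
    ring
  refine ⟨fun x y => le_rfl, fun x r hr => ?_, fun n m t _ t' _ => ?_,
    fun n m t t' => (hscale n m t t').le⟩
  · have hsub : {y | y ∈ Icc (0 : ℝ) 1 ∧ snowflake s x y < r} ⊆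
        Metric.ball x (r ^ (1 / (s : ℝ))) := by
      rintro y ⟨-, hy⟩
      rw [snowflake_apply] at hy
      rw [Metric.mem_ball, dist_comm, Real.dist_eq, one_div]
      exact (Real.lt_rpow_inv_iff_of_pos (abs_nonneg _) hr.le s.2.1).2 hy
    refine (measure_mono hsub).trans_eq ?_
    rw [Real.volume_ball]
  · rw [hscale]
    have := (snowflake s).nonneg t t'
    have : 0 ≤ (h ^ (s : ℝ)) ^ n * snowflake s t t' := by positivity
    linarith

/-! ### Test functions for d_R and bounds at scale one. -/

section

variable {s : Ioc (0 : ℝ) 1} {l : ℕ} (hl : LargeEnough s l)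

theorem shortcutSemidistance_le (x y : ℝ) :
    shortcutSemidistance s l hl x y ≤ |x - y| ^ (s : ℝ) :=
  quotientSemidistance_le _ _ x y

theorem shortcutSemidistance_eq_zero {n : ℕ} {p q : ℝ} (h : IsShortcut l n p q) :
    shortcutSemidistance s l hl p q = 0 :=
  quotientSemidistance_eq_zero _ _ (Or.inr (Or.inl (mem_shortcuts_iff.2 ⟨n, h⟩)))

theorem le_add_shortcutSemidistance {f : ℝ → ℝ} (hf : ∀ x y, f y ≤ f x + |x - y| ^ (s : ℝ))
    (hR : ∀ n p q, IsShortcut l n p q → f p = f q) (x y : ℝ) :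
    f y ≤ f x + shortcutSemidistance s l hl x y := by
  refine le_add_quotientSemidistance _ _ hf (fun p q hpq => ?_) x y
  rcases hpq with rfl | h | h
  · rfl
  · obtain ⟨n, h⟩ := mem_shortcuts_iff.1 h
    exact hR n p q h
  · obtain ⟨n, h⟩ := mem_shortcuts_iff.1 h
    exact (hR n q p h).symm

theorem shortcutSemidistance_right_eq {n : ℕ} {p q : ℝ} (h : IsShortcut l n p q) (x : ℝ) :
    shortcutSemidistance s l hl x p = shortcutSemidistance s l hl x q := by
  have h0 := shortcutSemidistance_eq_zero hl h
  have h1 := (shortcutSemidistance s l hl).triangle x p q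
  have h2 := (shortcutSemidistance s l hl).triangle x q p
  rw [(shortcutSemidistance s l hl).symm q p] at h2
  linarith

/-- The similarity sends shortcuts to shortcuts n levels finer, so the rescaled pullback of d_R is
itself an admissible test function. -/
theorem shortcutSemidistance_scale_le (n : ℕ) (m : ℤ) (x y : ℝ) :
    shortcutSemidistance s l hl (scale l ^ n * (m + x)) (scale l ^ n * (m + y)) ≤
      (scale l ^ (s : ℝ)) ^ n * shortcutSemidistance s l hl x y := by
  set d := shortcutSemidistance s l hl with hd
  have hμ : 0 < (scale l ^ (s : ℝ)) ^ n := pow_pos LargeEnough.rpow_scale_pos n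
  have key := le_add_shortcutSemidistance hl
    (f := fun z => ((scale l ^ (s : ℝ)) ^ n)⁻¹ *
      d (scale l ^ n * (m + x)) (scale l ^ n * (m + z))) ?_ ?_ x y
  · simp only [d.refl, mul_zero, zero_add] at key
    rwa [inv_mul_le_iff₀ hμ] at key
  · intro y z
    have h1 := d.triangle (scale l ^ n * (m + x)) (scale l ^ n * (m + y)) (scale l ^ n * (m + z))
    have h2 := shortcutSemidistance_le hl (scale l ^ n * (m + y)) (scale l ^ n * (m + z))
    rw [← mul_sub, abs_pow_mul_rpow (scale_pos l), add_sub_add_left_eq_sub] at h2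
    rw [inv_mul_le_iff₀ hμ, mul_add ((scale l ^ (s : ℝ)) ^ n), mul_inv_cancel_left₀ hμ.ne']
    linarith
  · intro i p q h
    have h' := (h.add_intCast m).mul_scale_pow n
    rw [add_comm p, add_comm q] at h'
    simp only [hd, shortcutSemidistance_right_eq hl h']

/-- A lower bound for `d_R` between points that are not close to each other. -/
theorem le_shortcutSemidistance_cantorStair (x y : ℝ) :
    scale l ^ (s : ℝ) * min 1 |cantorStair (2 ^ l) x - cantorStair (2 ^ l) y| ≤
      shortcutSemidistance s l hl x y := by
  have h3 : 3 ≤ 2 ^ l := by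
    have := Nat.pow_le_pow_right (n := 2) (by norm_num) hl.two_le
    omega
  have hμ := LargeEnough.rpow_scale_pos (s := s) (l := l)
  have hb := hl.two_pow_rpow_le
  have e : scale l ^ (s : ℝ) * (2 ^ l) ^ (s : ℝ) = 1 := by
    rw [← Real.mul_rpow (scale_pos l).le (by positivity), scale_mul, Real.one_rpow]
  have key := le_add_shortcutSemidistance hl
    (f := fun z => scale l ^ (s : ℝ) *
      min 1 |cantorStair (2 ^ l) x - cantorStair (2 ^ l) z|) ?_ ?_ x y
  · simpa using key
  · intro y z
    have h1 := min_cantorStair_le h3 s.2.1 (by push_cast; exact hb) y z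
    push_cast at h1
    have h2 : min 1 |cantorStair (2 ^ l) x - cantorStair (2 ^ l) z| ≤
        min 1 |cantorStair (2 ^ l) x - cantorStair (2 ^ l) y| +
        min 1 |cantorStair (2 ^ l) y - cantorStair (2 ^ l) z| := by
      have := abs_sub_le (cantorStair (2 ^ l) x) (cantorStair (2 ^ l) y) (cantorStair (2 ^ l) z)
      have := abs_nonneg (cantorStair (2 ^ l) x - cantorStair (2 ^ l) y)
      have := abs_nonneg (cantorStair (2 ^ l) y - cantorStair (2 ^ l) z)
      rw [min_def, min_def, min_def]
      split_ifs <;> linarith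
    calc _ ≤ scale l ^ (s : ℝ) * (min 1 |cantorStair (2 ^ l) x - cantorStair (2 ^ l) y| +
          (2 ^ l) ^ (s : ℝ) * |y - z| ^ (s : ℝ)) := by
            gcongr
            exact h2.trans (by gcongr)
      _ = _ := by linear_combination |y - z| ^ (s : ℝ) * e
  · intro n p q h
    simp only [cantorStair_eq_of_isShortcut hl.two_le h]

/-- The lower bound for the distances between separated points at scale `1`. -/
def gapBound (s : Ioc (0 : ℝ) 1) (l : ℕ) : ℝ := scale l ^ (s : ℝ) * (1 / (2 ^ l - 1))

include hl in
theorem eight_le_two_pow : (8 : ℝ) ≤ 2 ^ l := by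
  have := pow_le_pow_right₀ (by norm_num : (1 : ℝ) ≤ 2) hl.three_le
  linarith

include hl in
theorem gapBound_pos : 0 < gapBound s l := by
  have := LargeEnough.rpow_scale_pos (s := s) (l := l)
  have := eight_le_two_pow hl
  exact mul_pos ‹_› (one_div_pos.2 (by linarith))

include hl in
theorem gapBound_le_one : gapBound s l ≤ 1 := by
  have h8 := eight_le_two_pow hl
  refine mul_le_one₀ ?_ (one_div_nonneg.2 (by linarith)) ?_
  · linarith [hl.1]
  · rw [div_le_one] <;> linarith

theorem gapBound_le_of_le_cantorStair {x y : ℝ}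
    (h : 1 / (2 ^ l - 1) ≤ |cantorStair (2 ^ l) x - cantorStair (2 ^ l) y|) :
    gapBound s l ≤ shortcutSemidistance s l hl x y := by
  have h8 := eight_le_two_pow hl
  refine le_trans ?_ (le_shortcutSemidistance_cantorStair hl x y)
  refine mul_le_mul_of_nonneg_left (le_min ?_ h) LargeEnough.rpow_scale_pos.le
  rw [div_le_one] <;> linarith

theorem gapBound_le_of_one_le {x y : ℝ} (h : 1 ≤ |x - y|) :
    gapBound s l ≤ shortcutSemidistance s l hl x y := by
  wlog hxy : x ≤ y generalizing x y
  · rw [(shortcutSemidistance s l hl).symm]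
    exact this (by rwa [abs_sub_comm]) (le_of_not_ge hxy)
  have h8 := eight_le_two_pow hl
  have h3 : 3 ≤ 2 ^ l := by
    have := Nat.pow_le_pow_right (n := 2) (by norm_num) hl.two_le
    omega
  rw [abs_sub_comm, abs_of_nonneg (by linarith)] at h
  have h1 := cantorStair_mono h3 (show x + (1 : ℤ) ≤ y by push_cast; linarith)
  rw [cantorStair_add_intCast h3] at h1
  push_cast at h1
  refine gapBound_le_of_le_cantorStair hl ?_
  rw [abs_sub_comm]
  refine le_trans ?_ (le_abs_self _)
  refine le_trans (?_ : _ ≤ (1 : ℝ)) (by linarith)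
  rw [div_le_one] <;> linarith

include hl in
theorem cantorStair_mul_scale {k : ℕ} (hk : k ≤ 4) :
    cantorStair (2 ^ l) (k * scale l) = k / (2 ^ l - 1) := by
  have h3 := hl.three_le
  obtain ⟨j, rfl⟩ := Nat.exists_eq_add_of_le' (by omega : 1 ≤ l)
  have h4 : 4 ≤ 2 ^ j := by
    simpa using Nat.pow_le_pow_right (n := 2) (by norm_num) (by omega : 2 ≤ j)
  have e : 2 ^ (j + 1) = 2 ^ j + 2 ^ j := by ring
  have h := cantorStair_div (a := 2 ^ j) (k := k) (by omega) (by omega)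
  rw [← e] at h
  push_cast at h
  rw [← h, scale, one_div, ← div_eq_mul_inv]

include hl in
theorem cantorStair_of_mem_coarseGrid {p : ℝ} (hp : p ∈ coarseGrid l) :
    ∃ k : ℤ, (p = k ∧ cantorStair (2 ^ l) p = k) ∨
      (p = k + scale l ∧ cantorStair (2 ^ l) p = k + 1 / (2 ^ l - 1)) := by
  have h3 : 3 ≤ 2 ^ l := by
    have := Nat.pow_le_pow_right (n := 2) (by norm_num) hl.two_le
    omega
  obtain ⟨k, rfl | rfl⟩ := hp
  · refine ⟨k, Or.inl ⟨rfl, ?_⟩⟩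
    have h := cantorStair_mul_scale hl (k := 0) (by norm_num)
    have h' := cantorStair_add_intCast h3 0 k
    simp only [Nat.cast_zero, zero_mul, zero_div] at h
    simpa [h] using h'
  · refine ⟨k, Or.inr ⟨rfl, ?_⟩⟩
    have h := cantorStair_mul_scale hl (k := 1) (by norm_num)
    simp only [Nat.cast_one, one_mul] at h
    rw [add_comm, cantorStair_add_intCast h3, h, add_comm]

/-- The staircase takes the values k and k + 1/(b - 1) on the grid, and these are 1/(b -
1)-separated because b ≥ 8. -/
theorem gapBound_le_of_coarseGrid {p p' : ℝ} (hp : p ∈ coarseGrid l) (hp' : p' ∈ coarseGrid l)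
    (hne : p ≠ p') : gapBound s l ≤ shortcutSemidistance s l hl p p' := by
  have h8 := eight_le_two_pow hl
  have hε : (1 : ℝ) / (2 ^ l - 1) ≤ 1 / 7 := one_div_le_one_div_of_le (by norm_num) (by linarith)
  have hε0 : (0 : ℝ) < 1 / (2 ^ l - 1) := one_div_pos.2 (by linarith)
  refine gapBound_le_of_le_cantorStair hl ?_
  obtain ⟨k, hk⟩ := cantorStair_of_mem_coarseGrid hl hp
  obtain ⟨k', hk'⟩ := cantorStair_of_mem_coarseGrid hl hp'
  generalize (1 : ℝ) / (2 ^ l - 1) = ε at *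
  rcases hk with ⟨hk, e⟩ | ⟨hk, e⟩ <;> rcases hk' with ⟨hk', e'⟩ | ⟨hk', e'⟩ <;>
  rw [e, e', le_abs] <;> rcases lt_trichotomy k k' with h | rfl | h <;>
  first
  | exact absurd (hk.trans hk'.symm) hne
  | (have h' : (k : ℝ) + 1 ≤ k' := by exact_mod_cast h
     right
     linarith)
  | (have h' : (k' : ℝ) + 1 ≤ k := by exact_mod_cast h
     left
     linarith)
  | (left; linarith)
  | (right; linarith)

/-- The reason for the model interval [2h, 3h]: the staircase maps it to [2/(b - 1), 3/(b - 1)],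
away from its values on the grid, so coarse shortcuts do not reach it. -/
theorem gapBound_le_of_mem_Icc {t p : ℝ} (ht : t ∈ Icc (2 * scale l) (3 * scale l))
    (hp : p ∈ coarseGrid l) : gapBound s l ≤ shortcutSemidistance s l hl t p := by
  have h8 := eight_le_two_pow hl
  have h3 : 3 ≤ 2 ^ l := by
    have := Nat.pow_le_pow_right (n := 2) (by norm_num) hl.two_le
    omega
  have hε : (1 : ℝ) / (2 ^ l - 1) ≤ 1 / 7 := one_div_le_one_div_of_le (by norm_num) (by linarith)
  have h1 := cantorStair_mono h3 ht.1
  have h2 := cantorStair_mono h3 ht.2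
  have e2 := cantorStair_mul_scale hl (k := 2) (by norm_num)
  have e3 := cantorStair_mul_scale hl (k := 3) (by norm_num)
  push_cast at e2 e3
  rw [e2, ← mul_one_div] at h1
  rw [e3, ← mul_one_div] at h2
  refine gapBound_le_of_le_cantorStair hl ?_
  have hε0 : (0 : ℝ) < 1 / (2 ^ l - 1) := one_div_pos.2 (by linarith)
  obtain ⟨k, hk⟩ := cantorStair_of_mem_coarseGrid hl hp
  generalize (1 : ℝ) / (2 ^ l - 1) = ε at *
  rw [le_abs]
  rcases le_or_gt k 0 with h | h
  · have h' : (k : ℝ) ≤ 0 := by exact_mod_cast h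
    left
    rcases hk with ⟨-, e⟩ | ⟨-, e⟩ <;> linarith
  · have h' : (1 : ℝ) ≤ k := by exact_mod_cast h
    right
    rcases hk with ⟨-, e⟩ | ⟨-, e⟩ <;> linarith

end

/-! ### Truncating the semi-distance of the fine levels. -/

section

variable {s : Ioc (0 : ℝ) 1} {l : ℕ} (hl : LargeEnough s l)

/-- The quotient semi-distance of the shortcuts of levels greater than `n`. -/
def fineSemidistance (n : ℕ) (x y : ℝ) : ℝ :=
  (scale l ^ (s : ℝ)) ^ n * shortcutSemidistance s l hl ((2 ^ l) ^ n * x) ((2 ^ l) ^ n * y)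

theorem fineSemidistance_nonneg (n : ℕ) (x y : ℝ) : 0 ≤ fineSemidistance hl n x y :=
  mul_nonneg (pow_pos LargeEnough.rpow_scale_pos n).le ((shortcutSemidistance s l hl).nonneg _ _)

theorem fineSemidistance_self (n : ℕ) (x : ℝ) : fineSemidistance hl n x x = 0 := by
  rw [fineSemidistance, (shortcutSemidistance s l hl).refl, mul_zero]

theorem fineSemidistance_le_add (n : ℕ) (x y z : ℝ) :
    fineSemidistance hl n x z ≤ fineSemidistance hl n x y + |y - z| ^ (s : ℝ) := by
  have h1 := (shortcutSemidistance s l hl).triangle ((2 ^ l) ^ n * x) ((2 ^ l) ^ n * y)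
    ((2 ^ l) ^ n * z)
  have h2 := shortcutSemidistance_le hl ((2 ^ l) ^ n * y) ((2 ^ l) ^ n * z)
  rw [← mul_sub, abs_pow_mul_rpow (by positivity)] at h2
  have e : (scale l ^ (s : ℝ)) ^ n * ((2 ^ l) ^ (s : ℝ)) ^ n = 1 := by
    rw [← mul_pow, ← Real.mul_rpow (scale_pos l).le (by positivity), scale_mul, Real.one_rpow,
      one_pow]
  have h3 := mul_le_mul_of_nonneg_left (h1.trans (add_le_add_right h2 _))
    (pow_pos (LargeEnough.rpow_scale_pos (s := s) (l := l)) n).le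
  refine h3.trans_eq ?_
  unfold fineSemidistance
  linear_combination |y - z| ^ (s : ℝ) * e

theorem fineSemidistance_right_eq {n i : ℕ} (hi : n ≤ i) {p q : ℝ} (h : IsShortcut l i p q)
    (x : ℝ) : fineSemidistance hl n x p = fineSemidistance hl n x q := by
  obtain ⟨j, rfl⟩ := Nat.exists_eq_add_of_le' hi
  unfold fineSemidistance
  rw [shortcutSemidistance_right_eq hl h.mul_two_pow]

theorem shortcutSemidistance_le_fineSemidistance (n : ℕ) (x y : ℝ) :
    shortcutSemidistance s l hl x y ≤ fineSemidistance hl n x y := by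
  have h := shortcutSemidistance_scale_le hl n 0 ((2 ^ l) ^ n * x) ((2 ^ l) ^ n * y)
  rw [Int.cast_zero, zero_add, zero_add, ← mul_assoc, ← mul_assoc, scale_pow_mul, one_mul,
    one_mul] at h
  exact h

theorem abs_sub_lt_of_fineSemidistance_lt {n : ℕ} {x y : ℝ}
    (h : fineSemidistance hl n x y < gapBound s l * (scale l ^ (s : ℝ)) ^ n) :
    |y - x| < scale l ^ n := by
  have hμ := pow_pos (LargeEnough.rpow_scale_pos (s := s) (l := l)) n
  by_contra! hxy
  have h1 : 1 ≤ |(2 ^ l) ^ n * x - (2 ^ l) ^ n * y| := by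
    rw [← mul_sub, abs_mul, abs_of_pos (by positivity), abs_sub_comm]
    have := mul_le_mul_of_nonneg_left hxy (by positivity : (0 : ℝ) ≤ (2 ^ l) ^ n)
    rwa [mul_comm, scale_pow_mul] at this
  have := mul_le_mul_of_nonneg_left (gapBound_le_of_one_le hl h1) hμ.le
  unfold fineSemidistance at h
  linarith

theorem gapBound_le_fineSemidistance {n i j : ℕ} (hi : i < n) (hj : j < n) {p q p' q' : ℝ}
    (h : IsShortcut l i p q) (h' : IsShortcut l j p' q') {u u' : ℝ} (hu : u = p ∨ u = q)
    (hu' : u' = p' ∨ u' = q') (hne : u ≠ u') :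
    gapBound s l * (scale l ^ (s : ℝ)) ^ n ≤ fineSemidistance hl n u u' := by
  have hl1 : 1 ≤ l := by linarith [hl.two_le]
  have hg : (2 ^ l) ^ n * u ∈ coarseGrid l := by
    rcases hu with rfl | rfl
    exacts [(h.mem_coarseGrid hl1 hi).1, (h.mem_coarseGrid hl1 hi).2]
  have hg' : (2 ^ l) ^ n * u' ∈ coarseGrid l := by
    rcases hu' with rfl | rfl
    exacts [(h'.mem_coarseGrid hl1 hj).1, (h'.mem_coarseGrid hl1 hj).2]
  have := gapBound_le_of_coarseGrid hl hg hg' fun e => hne (mul_left_cancel₀ (by positivity) e)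
  rw [mul_comm]
  exact mul_le_mul_of_nonneg_left this (pow_pos LargeEnough.rpow_scale_pos n).le

/-- The test function is the fine semi-distance from the first point, truncated at `gapBound` times
μ^n. Fine shortcuts preserve it by scaling, and at the ends of coarse ones it is constantly equal to
the truncation height. -/
theorem gapBound_mul_le_shortcutSemidistance_scale (n : ℕ) (m : ℤ) {t t' : ℝ}
    (ht : t ∈ Icc (2 * scale l) (3 * scale l)) (ht' : t' ∈ Icc (2 * scale l) (3 * scale l)) :
    gapBound s l * ((scale l ^ (s : ℝ)) ^ n * shortcutSemidistance s l hl t t') ≤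
      shortcutSemidistance s l hl (scale l ^ n * (m + t)) (scale l ^ n * (m + t')) := by
  set d := shortcutSemidistance s l hl with hd
  have hc0 := gapBound_pos hl
  have hc1 := gapBound_le_one hl
  have hμ := pow_pos (LargeEnough.rpow_scale_pos (s := s) (l := l)) n
  have hl1 : 1 ≤ l := by linarith [hl.two_le]
  have hsub : ∀ z : ℝ, (2 ^ l) ^ n * (scale l ^ n * (m + z)) - m = z := by
    intro z
    linear_combination (m + z) * scale_pow_mul l n
  -- d_R is invariant under integer translations: the level-zero scaling bound is applied to m and
  -- to -m.
  have htr : ∀ z : ℝ, (scale l ^ (s : ℝ)) ^ n * d t ((2 ^ l) ^ n * z - m) =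
      fineSemidistance hl n (scale l ^ n * (m + t)) z := by
    intro z
    have h0 : ∀ (k : ℤ) (x y : ℝ), d (k + x) (k + y) ≤ d x y := fun k x y => by
      simpa using shortcutSemidistance_scale_le hl 0 k x y
    have h1 := h0 m t ((2 ^ l) ^ n * z - m)
    have h2 := h0 (-m) (m + t) ((2 ^ l) ^ n * z)
    push_cast at h2
    rw [neg_add_cancel_left, neg_add_eq_sub] at h2
    rw [add_sub_cancel] at h1
    have e : (2 ^ l) ^ n * (scale l ^ n * (m + t)) = m + t := by linarith [hsub t]
    rw [fineSemidistance, e, ← hd, le_antisymm h2 h1]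
  have key := le_add_shortcutSemidistance hl
    (f := fun z => min (gapBound s l * (scale l ^ (s : ℝ)) ^ n)
      (fineSemidistance hl n (scale l ^ n * (m + t)) z)) ?_ ?_
      (scale l ^ n * (m + t)) (scale l ^ n * (m + t'))
  · simp only [fineSemidistance_self] at key
    rw [min_eq_right (by positivity : 0 ≤ gapBound s l * (scale l ^ (s : ℝ)) ^ n), zero_add,
      ← htr, hsub] at key
    refine le_trans (le_min ?_ ?_) key
    · refine mul_le_mul_of_nonneg_left (mul_le_of_le_one_right hμ.le ?_) hc0.le
      refine (shortcutSemidistance_le hl t t').trans (Real.rpow_le_one (abs_nonneg _) ?_ s.2.1.le)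
      have h8 := eight_le_two_pow hl
      have := scale_mul l
      have := scale_pos l
      rw [abs_le]
      constructor <;> nlinarith [ht.1, ht.2, ht'.1, ht'.2]
    · refine mul_le_of_le_one_left (mul_nonneg hμ.le (d.nonneg _ _)) hc1
  · intro y z
    have := fineSemidistance_le_add hl n (scale l ^ n * (m + t)) y z
    have h0 : 0 ≤ |y - z| ^ (s : ℝ) := by positivity
    rw [min_add]
    exact min_le_min (by linarith) this
  · intro i p q h
    rcases le_or_gt n i with hi | hi
    · simp only [fineSemidistance_right_eq hl hi h]
    · have hg : ∀ u, (2 ^ l) ^ n * u ∈ coarseGrid l → gapBound s l * (scale l ^ (s : ℝ)) ^ n ≤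
          fineSemidistance hl n (scale l ^ n * (m + t)) u := by
        intro u hu
        rw [← htr, mul_comm]
        refine mul_le_mul_of_nonneg_left (gapBound_le_of_mem_Icc hl ht ?_) hμ.le
        obtain ⟨k, hk | hk⟩ := hu
        · exact ⟨k - m, Or.inl (by push_cast; linarith)⟩
        · exact ⟨k - m, Or.inr (by push_cast; linarith)⟩
      have := h.mem_coarseGrid hl1 hi
      simp only [min_eq_left (hg p this.1), min_eq_left (hg q this.2)]

/-- A ball of `d_R` is contained in the union of two balls of the line. -/
theorem exists_ball_cover {n : ℕ} {r : ℝ} (hr : 0 < r)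
    (hrn : 2 * r ≤ gapBound s l * (scale l ^ (s : ℝ)) ^ n) (x : ℝ) :
    ∃ p q : ℝ, ∀ y, shortcutSemidistance s l hl x y < r →
      |y - p| < scale l ^ n ∨ |y - q| < scale l ^ n := by
  set d := shortcutSemidistance s l hl with hd
  -- A ball that reaches a coarse shortcut may continue from its other end, hence two intervals;
  -- otherwise one interval around x is enough.
  by_cases hx : ∃ i p q, i < n ∧ IsShortcut l i p q ∧ d x p < r
  · obtain ⟨i, p, q, hi, h, hxp⟩ := hx
    refine ⟨p, q, fun y hy => ?_⟩
    -- The ball lies within 2r of p, and the test function is the truncated fine distance to the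
    -- pair {p, q}.
    have key := le_add_shortcutSemidistance hl
      (f := fun z => min (gapBound s l * (scale l ^ (s : ℝ)) ^ n)
        (min (fineSemidistance hl n p z) (fineSemidistance hl n q z))) ?_ ?_ p y
    · have h0 : min (gapBound s l * (scale l ^ (s : ℝ)) ^ n)
          (min (fineSemidistance hl n p p) (fineSemidistance hl n q p)) ≤ 0 :=
        (min_le_right _ _).trans ((min_le_left _ _).trans_eq (fineSemidistance_self hl n p))
      have h1 := d.triangle p x y
      rw [d.symm p x] at h1
      have h2 : min (gapBound s l * (scale l ^ (s : ℝ)) ^ n)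
          (min (fineSemidistance hl n p y) (fineSemidistance hl n q y)) <
          gapBound s l * (scale l ^ (s : ℝ)) ^ n := by
        refine lt_of_le_of_lt key ?_
        rw [← hd]
        linarith
      rcases min_lt_iff.1 h2 with h2 | h2
      · exact absurd h2 (lt_irrefl _)
      · rcases min_lt_iff.1 h2 with h2 | h2
        · exact Or.inl (abs_sub_lt_of_fineSemidistance_lt hl h2)
        · exact Or.inr (abs_sub_lt_of_fineSemidistance_lt hl h2)
    · intro y z
      have h1 := fineSemidistance_le_add hl n p y z
      have h2 := fineSemidistance_le_add hl n q y z
      have h0 : 0 ≤ |y - z| ^ (s : ℝ) := by positivity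
      rw [min_add, min_add]
      exact min_le_min (by linarith) (min_le_min h1 h2)
    · intro j p' q' h'
      rcases le_or_gt n j with hj | hj
      · simp only [fineSemidistance_right_eq hl hj h']
      · have hm := mem_shortcuts_iff.2 ⟨i, h⟩
        have hm' := mem_shortcuts_iff.2 ⟨j, h'⟩
        have h2 := hl.two_le
        have hc : 0 ≤ gapBound s l * (scale l ^ (s : ℝ)) ^ n :=
          mul_nonneg (gapBound_pos hl).le (pow_pos LargeEnough.rpow_scale_pos n).le
        -- Either the two coarse shortcuts coincide and the function vanishes at both ends, or they
        -- share no end and it equals the truncation height at both.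
        by_cases hp : p' = p
        · subst hp
          obtain rfl := shortcuts_right_unique h2 hm hm'
          simp only [fineSemidistance_self]
          rw [min_eq_left (fineSemidistance_nonneg hl n _ _),
            min_eq_right (fineSemidistance_nonneg hl n _ _)]
        · have hq : q' ≠ q := by
            rintro rfl
            exact hp (shortcuts_left_unique h2 hm' hm)
          have hp' : p' ≠ q := by
            rintro rfl
            exact shortcuts_not_chain h2 hm hm'
          have hq' : q' ≠ p := by
            rintro rfl
            exact shortcuts_not_chain h2 hm' hm
          have e := fun {u u' : ℝ} => gapBound_le_fineSemidistance hl hi hj h h' (u := u) (u' := u')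
          have e1 := e (Or.inl rfl) (Or.inl rfl) (Ne.symm hp)
          have e2 := e (Or.inl rfl) (Or.inr rfl) (Ne.symm hq')
          have e3 := e (Or.inr rfl) (Or.inl rfl) (Ne.symm hp')
          have e4 := e (Or.inr rfl) (Or.inr rfl) (Ne.symm hq)
          simp only [min_eq_left (le_min e1 e3), min_eq_left (le_min e2 e4)]
  · push Not at hx
    refine ⟨x, x, fun y hy => Or.inl ?_⟩
    -- Here truncation is at r: every coarse end is at d_R-distance at least r from x, and the fine
    -- semi-distance dominates d_R.
    have key := le_add_shortcutSemidistance hl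
      (f := fun z => min r (fineSemidistance hl n x z)) ?_ ?_ x y
    · simp only [fineSemidistance_self] at key
      rw [min_eq_right hr.le, zero_add] at key
      rcases min_lt_iff.1 (lt_of_le_of_lt key hy) with h2 | h2
      · exact absurd h2 (lt_irrefl _)
      · exact abs_sub_lt_of_fineSemidistance_lt hl (by linarith)
    · intro y z
      have h1 := fineSemidistance_le_add hl n x y z
      have h0 : 0 ≤ |y - z| ^ (s : ℝ) := by positivity
      rw [min_add]
      exact min_le_min (by linarith) h1
    · intro j p q h
      rcases le_or_gt n j with hj | hj
      · simp only [fineSemidistance_right_eq hl hj h]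
      · have h1 := hx j p q hj h
        have h2 := h1
        rw [hd, shortcutSemidistance_right_eq hl h] at h2
        have h3 := shortcutSemidistance_le_fineSemidistance hl n x p
        have h4 := shortcutSemidistance_le_fineSemidistance hl n x q
        simp only [min_eq_left (h1.trans h3), min_eq_left (h2.trans h4)]

theorem volume_shortcutSemidistance_le (x : ℝ) {r : ℝ} (hr : 0 < r) :
    volume {y | y ∈ Icc (0 : ℝ) 1 ∧ shortcutSemidistance s l hl x y < r} ≤
      ENNReal.ofReal (4 * (2 / (gapBound s l * scale l ^ (s : ℝ))) ^ (1 / (s : ℝ)) *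
        r ^ (1 / (s : ℝ))) := by
  have hc0 := gapBound_pos hl
  have hμ := LargeEnough.rpow_scale_pos (s := s) (l := l)
  have hμ1 := hl.1
  have hs := s.2.1
  have hh := scale_pos l
  rw [mul_assoc, ← Real.mul_rpow (by positivity) hr.le]
  -- With c = `gapBound`, R μ = 2r/c, so the n with μ^(n+1) < 2r/c ≤ μ^n satisfies h^n ≤ R^(1/s).
  set R := 2 / (gapBound s l * scale l ^ (s : ℝ)) * r with hR
  have hR0 : 0 < R := by positivity
  have hRe : R * scale l ^ (s : ℝ) = 2 * r / gapBound s l := by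
    rw [hR]
    field_simp
  rcases le_total (2 * r / gapBound s l) 1 with h | h
  · obtain ⟨n, h1, h2⟩ := exists_nat_pow_near_of_lt_one (by positivity) h hμ (by linarith)
    obtain ⟨p, q, hpq⟩ := exists_ball_cover hl (n := n) hr
      (by rw [div_le_iff₀ hc0] at h2; linarith) x
    have hsub : {y | y ∈ Icc (0 : ℝ) 1 ∧ shortcutSemidistance s l hl x y < r} ⊆
        Metric.ball p (scale l ^ n) ∪ Metric.ball q (scale l ^ n) := fun y hy => hpq y hy.2
    refine (measure_mono hsub).trans ((measure_union_le _ _).trans ?_)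
    rw [Real.volume_ball, Real.volume_ball, ← ENNReal.ofReal_add (by positivity) (by positivity)]
    refine ENNReal.ofReal_le_ofReal ?_
    have h3 : scale l ^ n ≤ R ^ (1 / (s : ℝ)) := by
      rw [one_div, Real.le_rpow_inv_iff_of_pos (by positivity) hR0.le hs, ← Real.rpow_pow_comm hh.le]
      rw [← hRe, pow_succ] at h1
      exact (lt_of_mul_lt_mul_right h1 hμ.le).le
    linarith
  · have hsub : {y | y ∈ Icc (0 : ℝ) 1 ∧ shortcutSemidistance s l hl x y < r} ⊆ Icc 0 1 :=
      fun y hy => hy.1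
    refine (measure_mono hsub).trans ?_
    rw [Real.volume_Icc]
    refine ENNReal.ofReal_le_ofReal ?_
    have h1 : 1 ≤ R := by nlinarith
    have := Real.one_le_rpow h1 (by positivity : 0 ≤ 1 / (s : ℝ))
    linarith

theorem shortcutSemidistance_isCoarselySelfSimilar :
    ∃ C, 0 < C ∧ IsCoarselySelfSimilar (shortcutSemidistance s l hl) (scale l) s C := by
  have hc0 := gapBound_pos hl
  have hμ := LargeEnough.rpow_scale_pos (s := s) (l := l)
  refine ⟨max (4 * (2 / (gapBound s l * scale l ^ (s : ℝ))) ^ (1 / (s : ℝ))) (gapBound s l)⁻¹,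
    lt_max_of_lt_right (by positivity), shortcutSemidistance_le hl, fun x r hr => ?_,
    fun n m t ht t' ht' => ?_, shortcutSemidistance_scale_le hl⟩
  · refine (volume_shortcutSemidistance_le hl x hr).trans (ENNReal.ofReal_le_ofReal ?_)
    gcongr
    exact le_max_left _ _
  · have h := gapBound_mul_le_shortcutSemidistance_scale hl n m ht ht'
    rw [← le_inv_mul_iff₀ hc0] at h
    refine h.trans (mul_le_mul_of_nonneg_right (le_max_right _ _) (PseudoMetric.nonneg _ _ _))

end

/-! ### A criterion for BPI spaces -/

/-- In every ball of radius `r ≤ 1` of `X` there is a closed copy of the model space `M`, scaled by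
`r` up to the factor `C`, whose mass is comparable to `r ^ α`; the mass of a ball of radius `r` is at
most `C r ^ α`, and the diameter of `X` is at most `C`. -/
structure HasModelCells {X : Type*} [MetricSpace X] [MeasurableSpace X] (ν : Measure X)
    (M : Type*) [PseudoMetricSpace M] (α C : ℝ) : Prop where
  one_le : 1 ≤ C
  dist_le : ∀ x y : X, dist x y ≤ C
  measure_ball_le : ∀ (x : X) (r : ℝ), 0 < r → ν (Metric.ball x r) ≤ ENNReal.ofReal (C * r ^ α)
  exists_cell : ∀ (x : X) (r : ℝ), 0 < r → r ≤ 1 → ∃ e : M → X, IsClosed (range e) ∧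
    (∀ a, e a ∈ Metric.ball x r) ∧ ENNReal.ofReal (C⁻¹ * r ^ α) ≤ ν (range e) ∧
    ∀ a b, C⁻¹ * (r * dist a b) ≤ dist (e a) (e b) ∧ dist (e a) (e b) ≤ C * (r * dist a b)

theorem Metric.exists_finset_separated_cover {X : Type*} [PseudoMetricSpace X] [CompactSpace X]
    (A : Set X) {ε : ℝ} (hε : 0 < ε) :
    ∃ N : Finset X, (∀ x ∈ N, x ∈ A) ∧ (∀ x ∈ N, ∀ y ∈ N, x ≠ y → ε < dist x y) ∧
      ∀ x ∈ A, ∃ y ∈ N, dist x y ≤ ε := by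
  lift ε to NNReal using hε.le
  have hε' : ε / 2 ≠ 0 := (half_pos (by exact_mod_cast hε)).ne'
  have hfin : Metric.packingNumber ε A ≠ ⊤ := by
    obtain ⟨N, hN, hNf, hc⟩ := Metric.exists_finite_isCover_of_totallyBounded hε'
      (isCompact_univ.totallyBounded.subset (subset_univ A))
    have h1 := Metric.packingNumber_two_mul_le_externalCoveringNumber (ε / 2) A
    have h2 := hc.externalCoveringNumber_le_encard
    rw [mul_div_cancel₀ _ two_ne_zero] at h1
    exact ((h1.trans h2).trans_lt hNf.encard_lt_top).ne
  have hN : (Metric.maximalSeparatedSet ε A).Finite := by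
    rw [← Set.encard_lt_top_iff, Metric.encard_maximalSeparatedSet hfin]
    exact hfin.lt_top
  refine ⟨hN.toFinset, fun x hx => Metric.maximalSeparatedSet_subset (hN.mem_toFinset.1 hx),
    fun x hx y hy hxy => ?_, fun x hx => ?_⟩
  · have : (ε : ℝ≥0∞) < edist x y := Metric.isSeparated_maximalSeparatedSet
      (hN.mem_toFinset.1 hx) (hN.mem_toFinset.1 hy) hxy
    rw [edist_nndist] at this
    exact_mod_cast this
  · obtain ⟨y, hy, h⟩ := Metric.isCover_maximalSeparatedSet hfin hx
    refine ⟨y, hN.mem_toFinset.2 hy, ?_⟩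
    change edist x y ≤ ε at h
    rw [edist_nndist] at h
    exact_mod_cast h

namespace HasModelCells

variable {X : Type*} [MetricSpace X] [MeasurableSpace X] {ν : Measure X}
  {M : Type*} [PseudoMetricSpace M] {α C : ℝ}

theorem mono (h : HasModelCells ν M α C) {C' : ℝ} (hC : C ≤ C') : HasModelCells ν M α C' := by
  have h1 := h.one_le
  have hinv : C'⁻¹ ≤ C⁻¹ := inv_anti₀ (by linarith) hC
  refine ⟨h1.trans hC, fun x y => (h.dist_le x y).trans hC, fun x r hr => ?_, fun x r hr hr1 => ?_⟩
  · exact (h.measure_ball_le x r hr).trans (ENNReal.ofReal_le_ofReal (by gcongr))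
  · obtain ⟨e, he, he1, he2, he3⟩ := h.exists_cell x r hr hr1
    refine ⟨e, he, he1, (ENNReal.ofReal_le_ofReal (by gcongr)).trans he2, fun a b => ?_⟩
    exact ⟨le_trans (by gcongr) (he3 a b).1, (he3 a b).2.trans (by gcongr)⟩

theorem le_measure_ball (h : HasModelCells ν M α C) (x : X) {r : ℝ} (hr : 0 < r) (hr1 : r ≤ 1) :
    ENNReal.ofReal (C⁻¹ * r ^ α) ≤ ν (Metric.ball x r) := by
  obtain ⟨e, -, he1, he2, -⟩ := h.exists_cell x r hr hr1
  exact he2.trans (measure_mono (range_subset_iff.2 he1))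

variable [BorelSpace X]

/-- The mass distribution principle. -/
theorem measure_le_hausdorffMeasure (h : HasModelCells ν M α C) (hα : 0 < α) (E : Set X) :
    ν E ≤ ENNReal.ofReal C * μH[α] E := by
  have hC : 0 < C := by linarith [h.one_le]
  have hC0 : ENNReal.ofReal C ≠ 0 := by simpa using hC
  have key : (ENNReal.ofReal C)⁻¹ • ν ≤ μH[α] := by
    refine Measure.le_hausdorffMeasure α _ 1 one_pos fun s hs => ?_
    rw [Measure.smul_apply, smul_eq_mul, ENNReal.inv_mul_le_iff hC0 ENNReal.ofReal_ne_top]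
    rcases s.eq_empty_or_nonempty with rfl | ⟨x, hx⟩
    · simp
    have hfin : Metric.ediam s ≠ ⊤ := (hs.trans_lt ENNReal.one_lt_top).ne
    set δ := (Metric.ediam s).toReal with hδ
    have hδ0 : 0 ≤ δ := ENNReal.toReal_nonneg
    rw [← ENNReal.ofReal_toReal hfin, ← hδ, ENNReal.ofReal_rpow_of_nonneg hδ0 hα.le,
      ← ENNReal.ofReal_mul hC.le]
    -- A set of diameter δ lies in open balls of every radius r > δ, but perhaps not of radius δ
    -- (which may be 0), so the ball bound is passed to the limit.
    have hlim : Filter.Tendsto (fun r : ℝ => ENNReal.ofReal (C * r ^ α)) (nhdsWithin δ (Ioi δ))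
        (nhds (ENNReal.ofReal (C * δ ^ α))) := by
      refine ENNReal.tendsto_ofReal (Filter.Tendsto.mono_left ?_ nhdsWithin_le_nhds)
      exact ((Real.continuousAt_rpow_const δ α (Or.inr hα.le)).tendsto).const_mul C
    refine ge_of_tendsto hlim ?_
    filter_upwards [self_mem_nhdsWithin] with r hr
    refine (measure_mono fun y hy => ?_).trans (h.measure_ball_le x r (hδ0.trans_lt hr))
    rw [Metric.mem_ball, dist_edist]
    exact (ENNReal.toReal_mono hfin (Metric.edist_le_ediam_of_mem hy hx)).trans_lt hr
  have := key E
  rwa [Measure.smul_apply, smul_eq_mul, ENNReal.inv_mul_le_iff hC0 ENNReal.ofReal_ne_top] at this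

theorem le_hausdorffMeasure (h : HasModelCells ν M α C) (hα : 0 < α) {E : Set X} {a : ℝ}
    (hE : ENNReal.ofReal a ≤ ν E) : ENNReal.ofReal (C⁻¹ * a) ≤ μH[α] E := by
  have hC : 0 < C := by linarith [h.one_le]
  have hC0 : ENNReal.ofReal C ≠ 0 := by simpa using hC
  have := hE.trans (h.measure_le_hausdorffMeasure hα E)
  rwa [ENNReal.ofReal_mul (by positivity), ENNReal.ofReal_inv_of_pos hC,
    ENNReal.inv_mul_le_iff hC0 ENNReal.ofReal_ne_top]

/-- Packing: the balls of radius ε/2 about the separated points are disjoint and contained in B(x,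
2r). -/
theorem card_mul_le (h : HasModelCells ν M α C) {x : X} {r ε : ℝ} (hε : 0 < ε) (hε1 : ε ≤ 1)
    (hεr : ε ≤ r) {N : Finset X} (hN : ∀ y ∈ N, y ∈ Metric.ball x r)
    (hsep : ∀ y ∈ N, ∀ z ∈ N, y ≠ z → ε < dist y z) :
    N.card * (C⁻¹ * (ε / 2) ^ α) ≤ C * (2 * r) ^ α := by
  have hC : 0 < C := by linarith [h.one_le]
  have h2r : 0 < 2 * r := by linarith
  have hdisj : (N : Set X).PairwiseDisjoint fun y => Metric.ball y (ε / 2) := by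
    intro y hy z hz hyz
    exact Metric.ball_disjoint_ball (by linarith [hsep y hy z hz hyz])
  have h1 : ∑ y ∈ N, ν (Metric.ball y (ε / 2)) ≤ ENNReal.ofReal (C * (2 * r) ^ α) := by
    rw [← measure_biUnion_finset hdisj fun y _ => measurableSet_ball]
    refine (measure_mono (iUnion₂_subset fun y hy => ?_)).trans (h.measure_ball_le x (2 * r) h2r)
    refine Metric.ball_subset_ball' ?_
    have := Metric.mem_ball.1 (hN y hy)
    linarith
  have h2 : ∑ y ∈ N, ENNReal.ofReal (C⁻¹ * (ε / 2) ^ α) ≤ ∑ y ∈ N, ν (Metric.ball y (ε / 2)) :=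
    Finset.sum_le_sum fun y _ => h.le_measure_ball y (by linarith) (by linarith)
  have h3 := h2.trans h1
  rw [Finset.sum_const, nsmul_eq_mul, ← ENNReal.ofReal_natCast, ← ENNReal.ofReal_mul
    (Nat.cast_nonneg _), ENNReal.ofReal_le_ofReal_iff (by positivity)] at h3
  exact h3

/-- Maximal ε-separated sets give covers by balls of diameter at most 2ε, whose number is bounded by
packing; the resulting sum does not depend on ε. -/
theorem hausdorffMeasure_ball_le [CompactSpace X] (h : HasModelCells ν M α C) (hα : 0 < α) (x : X)
    {r : ℝ} (hr : 0 < r) :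
    μH[α] (Metric.ball x r) ≤ ENNReal.ofReal (C ^ 2 * 8 ^ α * r ^ α) := by
  have hC : 0 < C := by linarith [h.one_le]
  have hm : 0 < min r 1 := lt_min hr one_pos
  set ε : ℕ → ℝ := fun n => min r 1 * (1 / ((n : ℝ) + 1)) with hεdef
  have hε : ∀ n, 0 < ε n := fun n => mul_pos hm Nat.one_div_pos_of_nat
  have hεm : ∀ n, ε n ≤ min r 1 := fun n => by
    refine mul_le_of_le_one_right hm.le ?_
    rw [div_le_one] <;> linarith [n.cast_nonneg (α := ℝ)]
  choose N hN hsep hcov using fun n => Metric.exists_finset_separated_cover (Metric.ball x r) (hε n)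
  have hlim : Filter.Tendsto (fun n => ENNReal.ofReal (2 * ε n)) Filter.atTop (nhds 0) := by
    rw [← ENNReal.ofReal_zero]
    refine ENNReal.tendsto_ofReal ?_
    simpa [ε] using (tendsto_one_div_add_atTop_nhds_zero_nat (𝕜 := ℝ)).const_mul (min r 1)
      |>.const_mul 2
  have hdiam : ∀ n (y : N n), Metric.ediam (Metric.closedBall (y : X) (ε n)) ≤
      ENNReal.ofReal (2 * ε n) := by
    intro n y
    rw [← Metric.closedEBall_ofReal (hε n).le]
    refine Metric.ediam_closedEBall_le.trans_eq ?_
    rw [ENNReal.ofReal_mul zero_le_two, ENNReal.ofReal_ofNat]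
  refine (Measure.hausdorffMeasure_le_liminf_sum α (Metric.ball x r) _ hlim
    (fun n (y : N n) => Metric.closedBall (y : X) (ε n)) (Filter.Eventually.of_forall hdiam)
    (Filter.Eventually.of_forall fun n z hz => ?_)).trans ?_
  · obtain ⟨y, hy, hzy⟩ := hcov n z hz
    exact mem_iUnion.2 ⟨⟨y, hy⟩, hzy⟩
  · refine Filter.liminf_le_of_frequently_le' (Filter.Frequently.of_forall fun n => ?_)
    calc ∑ y : N n, Metric.ediam (Metric.closedBall (y : X) (ε n)) ^ α
        ≤ ∑ _y : N n, ENNReal.ofReal (2 * ε n) ^ α :=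
          Finset.sum_le_sum fun y _ => ENNReal.rpow_le_rpow (hdiam n y) hα.le
      _ = ENNReal.ofReal ((N n).card * (2 * ε n) ^ α) := by
          rw [Finset.sum_const, Finset.card_univ, Fintype.card_coe, nsmul_eq_mul,
            ENNReal.ofReal_rpow_of_nonneg (by linarith [hε n]) hα.le,
            ENNReal.ofReal_mul (Nat.cast_nonneg _), ENNReal.ofReal_natCast]
      _ ≤ ENNReal.ofReal (C ^ 2 * 8 ^ α * r ^ α) := by
          refine ENNReal.ofReal_le_ofReal ?_
          have h1 := h.card_mul_le (hε n) ((hεm n).trans (min_le_right _ _))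
            ((hεm n).trans (min_le_left _ _)) (hN n) (hsep n)
          have h2 : (2 * ε n) ^ α = C * 4 ^ α * (C⁻¹ * (ε n / 2) ^ α) := by
            rw [show 2 * ε n = 4 * (ε n / 2) by ring,
              Real.mul_rpow (by norm_num) (by linarith [hε n])]
            field_simp
          have h3 : (8 : ℝ) ^ α * r ^ α = 4 ^ α * (2 * r) ^ α := by
            rw [← Real.mul_rpow (by norm_num) hr.le, ← Real.mul_rpow (by norm_num) (by linarith)]
            congr 1
            ring
          have h4 : 0 < C * (4 : ℝ) ^ α := by positivity
          rw [h2, mul_assoc (C ^ 2), h3]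
          nlinarith [mul_le_mul_of_nonneg_left h1 h4.le]

/-- Cells exist only for radii up to 1 while r may be as large as the diameter, which is at most C,
so cells are taken at radius r/C. The map goes back from one cell to the model and then into the
other cell. -/
theorem isBPI [CompactSpace X] (h : HasModelCells ν M α C) (hα : 0 < α) : IsBPI X α := by
  have h1 := h.one_le
  have hC : 0 < C := by linarith
  have hdiam : ∀ r : ℝ, 0 < r → ENNReal.ofReal r ≤ Metric.ediam (univ : Set X) → r / C ≤ 1 := by
    intro r hr hr1
    rw [div_le_one hC, ← ENNReal.ofReal_le_ofReal_iff hC.le]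
    refine hr1.trans (Metric.ediam_le fun x _ y _ => ?_)
    rw [edist_dist]
    exact ENNReal.ofReal_le_ofReal (h.dist_le x y)
  have hCα : 1 ≤ C ^ α := Real.one_le_rpow h1 hα.le
  have h8 : (1 : ℝ) ≤ 8 ^ α := Real.one_le_rpow (by norm_num) hα.le
  have hlow : ∀ r : ℝ, 0 < r → (C ^ 2 * C ^ α)⁻¹ * r ^ α = C⁻¹ * (C⁻¹ * (r / C) ^ α) := by
    intro r hr
    rw [Real.div_rpow hr.le hC.le]
    field_simp
  refine ⟨⟨inferInstance, hα, C ^ 2 * C ^ α * 8 ^ α, by positivity, fun x r hr hr1 => ⟨?_, ?_⟩⟩,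
    C ^ 2, (C ^ 2 * C ^ α)⁻¹, by positivity, by positivity, fun x y r t hr hr1 ht ht1 => ?_⟩
  · have h2 := h.le_hausdorffMeasure hα
      (h.le_measure_ball x (r := r / C) (by positivity) (hdiam r hr hr1))
    rw [← hlow r hr] at h2
    refine (ENNReal.ofReal_le_ofReal ?_).trans (h2.trans (measure_mono
      (Metric.ball_subset_ball (div_le_self hr.le h1))))
    refine mul_le_mul_of_nonneg_right (inv_anti₀ (by positivity) ?_) (by positivity)
    exact le_mul_of_one_le_right (by positivity) h8
  · refine (h.hausdorffMeasure_ball_le hα x hr).trans (ENNReal.ofReal_le_ofReal ?_)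
    have : C ^ 2 ≤ C ^ 2 * C ^ α := le_mul_of_one_le_right (by positivity) hCα
    gcongr
  · obtain ⟨e, he, he1, he2, he3⟩ := h.exists_cell x (r / C) (by positivity) (hdiam r hr hr1)
    obtain ⟨e', -, he1', -, he3'⟩ := h.exists_cell y (t / C) (by positivity) (hdiam t ht ht1)
    -- `M` is only pseudometric, so a preimage under `e` need not be unique; any choice works
    -- because distances in `M` are controlled by those of the images.
    refine ⟨range e, he, range_subset_iff.2 fun a => Metric.ball_subset_ball
      (div_le_self hr.le h1) (he1 a), ?_, fun a => e' a.2.choose, fun a =>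
      Metric.ball_subset_ball (div_le_self ht.le h1) (he1' _), fun a b => ?_⟩
    · rw [hlow r hr]
      exact h.le_hausdorffMeasure hα he2
    · have ha := a.2.choose_spec
      have hb := b.2.choose_spec
      have e3 := he3 a.2.choose b.2.choose
      have e3' := he3' a.2.choose b.2.choose
      rw [ha, hb, ← Subtype.dist_eq] at e3
      set D := dist a.2.choose b.2.choose
      set D1 := dist (e' a.2.choose) (e' b.2.choose)
      constructor
      · calc (C ^ 2)⁻¹ * (r⁻¹ * dist a b) ≤ (C ^ 2)⁻¹ * (r⁻¹ * (C * (r / C * D))) := by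
              gcongr
              exact e3.2
          _ = t⁻¹ * (C⁻¹ * (t / C * D)) := by field_simp
          _ ≤ t⁻¹ * D1 := by
              gcongr
              exact e3'.1
      · calc t⁻¹ * D1 ≤ t⁻¹ * (C * (t / C * D)) := by
              gcongr
              exact e3'.2
          _ = C ^ 2 * (r⁻¹ * (C⁻¹ * (r / C * D))) := by field_simp
          _ ≤ C ^ 2 * (r⁻¹ * dist a b) := by
              gcongr
              exact e3.1

end HasModelCells

/-! ### ℓ¹ products and transport by isometries. -/

theorem PiLp.dist_eq_sum_of_one {ι : Type*} [Fintype ι] {X : ι → Type*}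
    [∀ k, PseudoMetricSpace (X k)] (x y : PiLp 1 X) : dist x y = ∑ k, dist (x k) (y k) := by
  rw [PiLp.dist_eq_sum (by simp)]
  simp

/-- The product measure turns products of balls and of cells into products of masses, so exponents
add up. An ℓ¹ ball lies in the product of balls of the same radius and contains the product of those
of radius r/n, where n is the number of factors. -/
theorem HasModelCells.pi {ι : Type*} [Fintype ι] [Nonempty ι] {X : ι → Type*}
    [∀ k, MetricSpace (X k)] [∀ k, MeasurableSpace (X k)] {ν : ∀ k, Measure (X k)}
    [∀ k, IsFiniteMeasure (ν k)] {M : ι → Type*} [∀ k, PseudoMetricSpace (M k)] {α : ι → ℝ} {C : ℝ}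
    (hα : ∀ k, 0 < α k) (h : ∀ k, HasModelCells (ν k) (M k) (α k) C) :
    ∃ C', HasModelCells ((Measure.pi ν).map (MeasurableEquiv.toLp 1 (∀ k, X k))) (PiLp 1 M)
      (∑ k, α k) C' := by
  have h1 : 1 ≤ C := (h (Classical.arbitrary ι)).one_le
  have hC : 0 < C := by linarith
  set n : ℝ := (Fintype.card ι : ℝ) with hn
  have hn1 : 1 ≤ n := by
    rw [hn]
    exact_mod_cast Fintype.card_pos (α := ι)
  have hn0 : 0 < n := by linarith
  have hnα : 1 ≤ n ^ ∑ k, α k := Real.one_le_rpow hn1 (Finset.sum_nonneg fun k _ => (hα k).le)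
  have hCn : 1 ≤ C ^ Fintype.card ι := one_le_pow₀ h1
  set C' : ℝ := n * C * (C ^ Fintype.card ι * n ^ ∑ k, α k) with hC'
  have hC'1 : n * C ≤ C' := le_mul_of_one_le_right (by positivity)
    (one_le_mul_of_one_le_of_one_le hCn hnα)
  have hC'2 : C ^ Fintype.card ι * n ^ ∑ k, α k ≤ C' := le_mul_of_one_le_left (by positivity)
    (one_le_mul_of_one_le_of_one_le hn1 h1)
  have hC'3 : C ^ Fintype.card ι ≤ C' := le_trans (le_mul_of_one_le_right (by positivity) hnα) hC'2
  have hC'0 : 0 < C' := by positivity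
  have hprod : ∀ {c r : ℝ}, 0 ≤ c → 0 < r → ∏ k, ENNReal.ofReal (c * r ^ α k) =
      ENNReal.ofReal (c ^ Fintype.card ι * r ^ ∑ k, α k) := by
    intro c r hc hr
    rw [← ENNReal.ofReal_prod_of_nonneg fun k _ => by positivity, Finset.prod_mul_distrib,
      Finset.prod_const, Finset.card_univ, Real.rpow_sum_of_pos hr]
  refine ⟨C', le_trans (one_le_mul_of_one_le_of_one_le hn1 h1) hC'1, fun x y => ?_,
    fun x r hr => ?_, fun x r hr hr1 => ?_⟩
  · rw [PiLp.dist_eq_sum_of_one]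
    refine (Finset.sum_le_card_nsmul _ _ C fun k _ => (h k).dist_le _ _).trans ?_
    rw [nsmul_eq_mul, Finset.card_univ]
    exact hC'1
  · rw [MeasurableEquiv.map_apply]
    have hsub : MeasurableEquiv.toLp 1 (∀ k, X k) ⁻¹' Metric.ball x r ⊆
        univ.pi fun k => Metric.ball (x k) r := by
      intro y hy k _
      rw [mem_preimage, Metric.mem_ball, PiLp.dist_eq_sum_of_one] at hy
      exact (Finset.single_le_sum (f := fun k => dist (y k) (x k)) (fun k _ => dist_nonneg)
        (Finset.mem_univ k)).trans_lt hy
    refine (measure_mono hsub).trans ?_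
    rw [Measure.pi_pi]
    refine (Finset.prod_le_prod' fun k _ => (h k).measure_ball_le (x k) r hr).trans ?_
    rw [hprod hC.le hr]
    exact ENNReal.ofReal_le_ofReal (by gcongr)
  · choose e he he1 he2 he3 using fun k => (h k).exists_cell (x k) (r / n) (by positivity)
      ((div_le_self hr.le hn1).trans hr1)
    have hrange : range (fun a : PiLp 1 M => (WithLp.toLp 1 fun k => e k (a k) : PiLp 1 X)) =
        WithLp.ofLp ⁻¹' univ.pi fun k => range (e k) := by
      ext y
      constructor
      · rintro ⟨a, rfl⟩ k -
        exact ⟨a k, rfl⟩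
      · intro hy
        choose a ha using fun k => hy k (mem_univ k)
        refine ⟨WithLp.toLp 1 a, ?_⟩
        ext k
        exact ha k
    refine ⟨fun a => WithLp.toLp 1 fun k => e k (a k), ?_, fun a => ?_, ?_, fun a b => ?_⟩
    · rw [hrange]
      exact (isClosed_set_pi fun k _ => he k).preimage (PiLp.continuous_ofLp 1 X)
    · rw [Metric.mem_ball, PiLp.dist_eq_sum_of_one]
      calc ∑ k, dist (e k (a k)) (x k) < ∑ _k : ι, r / n :=
            Finset.sum_lt_sum_of_nonempty Finset.univ_nonempty fun k _ => he1 k (a k)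
        _ = r := by
            rw [Finset.sum_const, nsmul_eq_mul, Finset.card_univ, ← hn]
            field_simp
    · rw [hrange, MeasurableEquiv.map_apply]
      change _ ≤ Measure.pi ν (univ.pi fun k => range (e k))
      rw [Measure.pi_pi]
      refine le_trans ?_ (Finset.prod_le_prod' fun k _ => he2 k)
      rw [hprod (by positivity) (by positivity), Real.div_rpow hr.le hn0.le]
      refine ENNReal.ofReal_le_ofReal ?_
      calc C'⁻¹ * r ^ ∑ k, α k ≤ (C ^ Fintype.card ι * n ^ ∑ k, α k)⁻¹ * r ^ ∑ k, α k := by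
            gcongr
        _ = _ := by
            rw [inv_pow]
            field_simp
    · rw [PiLp.dist_eq_sum_of_one, PiLp.dist_eq_sum_of_one, Finset.mul_sum, Finset.mul_sum,
        Finset.mul_sum]
      refine ⟨Finset.sum_le_sum fun k _ => le_trans ?_ (he3 k _ _).1,
        Finset.sum_le_sum fun k _ => (he3 k _ _).2.trans ?_⟩
      · calc C'⁻¹ * (r * dist (a k) (b k)) ≤ (n * C)⁻¹ * (r * dist (a k) (b k)) := by gcongr
          _ = _ := by field_simp
      · have : C ≤ C' := le_trans (le_mul_of_one_le_left hC.le hn1) hC'1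
        have : r / n ≤ r := div_le_self hr.le hn1
        gcongr

theorem IsBPI.of_isometryEquiv {X Y : Type*} [MetricSpace X] [MeasurableSpace X] [BorelSpace X]
    [MetricSpace Y] [MeasurableSpace Y] [BorelSpace Y] (e : X ≃ᵢ Y) {α : ℝ} (h : IsBPI Y α) :
    IsBPI X α := by
  obtain ⟨⟨hc, hα, K, hK, hball⟩, C, θ, hC, hθ, hBPI⟩ := h
  have hd : Metric.ediam (univ : Set X) = Metric.ediam (univ : Set Y) := e.ediam_univ
  refine ⟨⟨e.completeSpace, hα, K, hK, fun x r hr hr1 => ?_⟩, C, θ, hC, hθ,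
    fun x y r t hr hr1 ht ht1 => ?_⟩
  · have := hball (e x) r hr (hd ▸ hr1)
    rwa [← e.image_ball, e.hausdorffMeasure_image] at this
  · obtain ⟨A, hA, hA1, hA2, f, hf, hf1⟩ := hBPI (e x) (e y) r t hr (hd ▸ hr1) ht (hd ▸ ht1)
    refine ⟨e ⁻¹' A, hA.preimage e.continuous, ?_, ?_, fun a => e.symm (f ⟨e a, a.2⟩), fun a => ?_,
      fun a b => ?_⟩
    · intro z hz
      have := hA1 hz
      rwa [Metric.mem_ball, e.dist_eq] at this
    · rwa [e.hausdorffMeasure_preimage]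
    · have := hf ⟨e a, a.2⟩
      rw [Metric.mem_ball] at this ⊢
      rwa [← e.dist_eq, e.apply_symm_apply]
    · have := hf1 ⟨e a, a.2⟩ ⟨e b, b.2⟩
      rw [Subtype.dist_eq, e.dist_eq] at this
      rw [e.symm.dist_eq, Subtype.dist_eq]
      exact this

/-! ### The factors and the cube -/

theorem PseudoMetric.surjective_proj {X : Type*} (d : PseudoMetric X ℝ) :
    Function.Surjective d.proj :=
  SeparationQuotient.surjective_mk (X := d.Space)

theorem PseudoMetric.exists_isometryEquiv {X Y : Type*} [MetricSpace Y] (d : PseudoMetric X ℝ)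
    {F : X → Y} (hF : Function.Surjective F) (hd : ∀ x y, dist (F x) (F y) = d x y) :
    ∃ Φ : d.QuotSpace ≃ᵢ Y, ∀ x, Φ (d.proj x) = F x := by
  set f : d.QuotSpace → Y := fun q => F (Function.surjInv d.surjective_proj q) with hf
  have hproj : ∀ x, f (d.proj x) = F x := by
    intro x
    rw [← dist_eq_zero, hf, hd, ← d.dist_proj, Function.surjInv_eq d.surjective_proj, dist_self]
  have hiso : Isometry f := Isometry.of_dist_eq fun p q => by
    obtain ⟨x, rfl⟩ := d.surjective_proj p
    obtain ⟨y, rfl⟩ := d.surjective_proj q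
    rw [hproj, hproj, hd, d.dist_proj]
  have hsurj : Function.Surjective f := fun y => by
    obtain ⟨x, rfl⟩ := hF y
    exact ⟨d.proj x, hproj x⟩
  exact ⟨⟨Equiv.ofBijective f ⟨hiso.injective, hsurj⟩, hiso⟩, hproj⟩

namespace IsCoarselySelfSimilar

variable {d : PseudoMetric ℝ ℝ} {h σ C : ℝ}

theorem continuous_proj (hd : IsCoarselySelfSimilar d h σ C) (hσ : 0 < σ) (S : Set ℝ) :
    Continuous (d.restrict S).proj := by
  rw [continuous_iff_continuousAt]
  intro x
  rw [ContinuousAt, tendsto_iff_dist_tendsto_zero]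
  have h1 : Filter.Tendsto (fun y : S => |(y : ℝ) - x| ^ σ) (nhds x) (nhds 0) := by
    have : Continuous fun y : S => |(y : ℝ) - x| ^ σ :=
      (continuous_abs.comp (continuous_subtype_val.sub continuous_const)).rpow_const
        fun _ => Or.inr hσ.le
    simpa [Real.zero_rpow hσ.ne'] using this.tendsto x
  exact squeeze_zero (fun _ => dist_nonneg) (fun y => hd.le_rpow y x) h1

theorem compactSpace (hd : IsCoarselySelfSimilar d h σ C) (hσ : 0 < σ) :
    CompactSpace (d.restrict (Icc 0 1)).QuotSpace := by
  rw [← isCompact_univ_iff, ← (d.restrict (Icc 0 1)).surjective_proj.range_eq]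
  exact isCompact_range (hd.continuous_proj hσ _)

theorem exists_adic_cell {b : ℕ} (hb : 0 < b) {x : ℝ} (hx : x ∈ Icc (0 : ℝ) 1) :
    ∃ m : ℤ, (0 : ℝ) ≤ m ∧ (m : ℝ) + 1 ≤ b ∧ (m : ℝ) ≤ b * x ∧ b * x ≤ m + 1 := by
  have hb' : (1 : ℝ) ≤ b := by exact_mod_cast hb
  rcases hx.2.lt_or_eq with h | rfl
  · refine ⟨⌊b * x⌋, ?_, ?_, Int.floor_le _, (Int.lt_floor_add_one _).le⟩
    · exact_mod_cast Int.floor_nonneg.2 (mul_nonneg (by linarith) hx.1)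
    · have h1 : (b * x : ℝ) < (b : ℤ) := by
        push_cast
        nlinarith
      have h2 := Int.floor_lt.2 h1
      exact_mod_cast h2
  -- The endpoint x = 1 belongs to the last cell, not to the one given by the floor.
  · refine ⟨(b : ℤ) - 1, ?_, ?_, ?_, ?_⟩ <;> push_cast <;> linarith

/-- The mass is Lebesgue measure pushed to the quotient, and the cells are the images of h^(n+1)(m +
[2h, 3h]) inside an adic interval containing the centre. -/
theorem hasModelCells {l : ℕ} (hl : 2 ≤ l) (hσ : 0 < σ) (hC : 0 < C)
    (hd : IsCoarselySelfSimilar d (scale l) σ C) :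
    ∃ C', HasModelCells ((volume.comap ((↑) : Icc (0 : ℝ) 1 → ℝ)).map (d.restrict (Icc 0 1)).proj)
      (d.restrict (Icc (2 * scale l) (3 * scale l))).Space (1 / σ) C' := by
  have hh := scale_pos l
  have he := scale_mul l
  have hh4 : scale l ≤ 1 / 4 := by
    have : (2 : ℝ) ^ 2 ≤ 2 ^ l := pow_le_pow_right₀ (by norm_num) hl
    nlinarith
  set h := scale l with hh_def
  set μ := h ^ σ with hμ_def
  have hμ : 0 < μ := Real.rpow_pos_of_pos hh _
  have hμ1 : μ < 1 := Real.rpow_lt_one hh.le (by linarith) hσ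
  -- The term h^-2 pays for the length h^(n+2) of a cell against h^n ≥ r^(1/σ); the term C/μ pays
  -- for the ratio between r and μ^(n+1).
  set C' : ℝ := max 1 (max (h ^ 2)⁻¹ (C * μ⁻¹)) with hC'
  have hC'1 : 1 ≤ C' := le_max_left _ _
  have hC'2 : (h ^ 2)⁻¹ ≤ C' := (le_max_left _ _).trans (le_max_right _ _)
  have hC'3 : C * μ⁻¹ ≤ C' := (le_max_right _ _).trans (le_max_right _ _)
  have hC'4 : C ≤ C' := le_trans (le_mul_of_one_le_right hC.le (one_le_inv₀ hμ |>.2 hμ1.le)) hC'3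
  have hC'0 : 0 < C' := by linarith
  have hcont := hd.continuous_proj hσ (Icc 0 1)
  have hemb := MeasurableEmbedding.subtype_coe (measurableSet_Icc (a := (0 : ℝ)) (b := 1))
  refine ⟨C', hC'1, fun p q => ?_, fun p r hr => ?_, fun p r hr hr1 => ?_⟩
  · obtain ⟨x, rfl⟩ := (d.restrict (Icc 0 1)).surjective_proj p
    obtain ⟨y, rfl⟩ := (d.restrict (Icc 0 1)).surjective_proj q
    refine le_trans ((hd.le_rpow x y).trans (Real.rpow_le_one (abs_nonneg _) ?_ hσ.le)) hC'1
    rw [abs_le]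
    constructor <;> linarith [x.2.1, x.2.2, y.2.1, y.2.2]
  · obtain ⟨x, rfl⟩ := (d.restrict (Icc 0 1)).surjective_proj p
    rw [Measure.map_apply hcont.measurable measurableSet_ball, hemb.comap_apply]
    refine le_trans (measure_mono ?_) ((hd.volume_le x r hr).trans
      (ENNReal.ofReal_le_ofReal (by gcongr)))
    rintro _ ⟨y, hy, rfl⟩
    refine ⟨y.2, ?_⟩
    rw [d.symm]
    exact hy
  · obtain ⟨x, rfl⟩ := (d.restrict (Icc 0 1)).surjective_proj p
    -- μ^(n+1) < r ≤ μ^n: two points of one h^(n+1)-adic interval are at distance less than r.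
    obtain ⟨n, hn1, hn2⟩ := exists_nat_pow_near_of_lt_one hr hr1 hμ hμ1
    obtain ⟨m, hm0, hm1, hm2, hm3⟩ := exists_adic_cell (b := (2 ^ l) ^ (n + 1)) (by positivity) x.2
    push_cast at hm1 hm2 hm3
    have hpow := scale_pow_mul l (n + 1)
    rw [← hh_def] at hpow
    have hhn : 0 < h ^ (n + 1) := by positivity
    have hbx : h ^ (n + 1) * ((2 ^ l) ^ (n + 1) * (x : ℝ)) = x := by
      rw [← mul_assoc, hpow, one_mul]
    have hx1 := mul_le_mul_of_nonneg_left hm2 hhn.le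
    have hx2 := mul_le_mul_of_nonneg_left hm3 hhn.le
    rw [hbx] at hx1 hx2
    have hm1' := mul_le_mul_of_nonneg_left hm1 hhn.le
    rw [hpow] at hm1'
    have hm0' := mul_nonneg hhn.le hm0
    have hmem : ∀ t ∈ Icc (2 * h) (3 * h), h ^ (n + 1) * (m + t) ∈ Icc (0 : ℝ) 1 := by
      rintro t ⟨ht1, ht2⟩
      constructor <;> nlinarith
    set e : (d.restrict (Icc (2 * h) (3 * h))).Space → (d.restrict (Icc (0 : ℝ) 1)).QuotSpace :=
      fun t => (d.restrict (Icc 0 1)).proj ⟨_, hmem t.1 t.2⟩ with he_def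
    set S : Set (Icc (0 : ℝ) 1) := (↑) ⁻¹' Icc (h ^ (n + 1) * (m + 2 * h)) (h ^ (n + 1) * (m + 3 * h))
      with hS
    have hrange : range e = (d.restrict (Icc 0 1)).proj '' S := by
      ext p
      constructor
      · rintro ⟨t, rfl⟩
        refine ⟨_, ⟨?_, ?_⟩, rfl⟩
        · exact mul_le_mul_of_nonneg_left (by linarith [t.2.1]) hhn.le
        · exact mul_le_mul_of_nonneg_left (by linarith [t.2.2]) hhn.le
      · rintro ⟨y, ⟨hy1, hy2⟩, rfl⟩
        have hy : h ^ (n + 1) * (m + ((2 ^ l) ^ (n + 1) * (y : ℝ) - m)) = y := by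
          rw [add_sub_cancel, ← mul_assoc, hpow, one_mul]
        refine ⟨⟨(2 ^ l) ^ (n + 1) * (y : ℝ) - m, ?_, ?_⟩, ?_⟩
        · rw [← hy] at hy1
          linarith [le_of_mul_le_mul_left hy1 hhn]
        · rw [← hy] at hy2
          linarith [le_of_mul_le_mul_left hy2 hhn]
        · exact congrArg (d.restrict (Icc 0 1)).proj (a₁ := ⟨_, _⟩) (Subtype.ext hy)
    have hdist : ∀ a b, dist (e a) (e b) = d (h ^ (n + 1) * (m + a.1)) (h ^ (n + 1) * (m + b.1)) :=
      fun a b => rfl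
    have hcl : IsClosed (range e) := by
      rw [hrange]
      exact ((isClosed_Icc.preimage continuous_subtype_val).isCompact.image hcont).isClosed
    refine ⟨e, hcl, fun t => ?_, ?_, fun a b => ?_⟩
    · have h1 : |h ^ (n + 1) * (m + t.1) - x| ^ σ < (h ^ (n + 1)) ^ σ := by
        refine Real.rpow_lt_rpow (abs_nonneg _) ?_ hσ
        have h2 := mul_le_mul_of_nonneg_left t.2.1 hhn.le
        have h3 := mul_le_mul_of_nonneg_left t.2.2 hhn.le
        have h4 : 0 < h ^ (n + 1) * h := by positivity
        have h5 : h ^ (n + 1) * h ≤ h ^ (n + 1) * (1 / 4) :=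
          mul_le_mul_of_nonneg_left hh4 hhn.le
        rw [abs_lt]
        constructor <;> linarith
      rw [← Real.rpow_pow_comm hh.le] at h1
      exact (hd.le_rpow _ _).trans_lt (h1.trans hn1)
    · rw [Measure.map_apply hcont.measurable hcl.measurableSet, hemb.comap_apply, hrange]
      have hsub : Icc (h ^ (n + 1) * (m + 2 * h)) (h ^ (n + 1) * (m + 3 * h)) ⊆
          (↑) '' ((d.restrict (Icc 0 1)).proj ⁻¹' ((d.restrict (Icc 0 1)).proj '' S)) := by
        intro y hy
        have h2 := hmem (2 * h) ⟨le_rfl, by linarith⟩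
        have h3 := hmem (3 * h) ⟨by linarith, le_rfl⟩
        exact ⟨⟨y, h2.1.trans hy.1, hy.2.trans h3.2⟩, subset_preimage_image _ S hy, rfl⟩
      refine le_trans ?_ (measure_mono hsub)
      rw [Real.volume_Icc]
      refine ENNReal.ofReal_le_ofReal ?_
      have h1 : r ^ (1 / σ) ≤ h ^ n := by
        rw [one_div, Real.rpow_inv_le_iff_of_pos hr.le (by positivity) hσ, ← Real.rpow_pow_comm hh.le]
        exact hn2
      have h2 : C'⁻¹ ≤ h ^ 2 := inv_le_of_inv_le₀ (by positivity) hC'2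
      calc C'⁻¹ * r ^ (1 / σ) ≤ h ^ 2 * h ^ n := by gcongr
        _ = _ := by ring
    · have h1 := hd.scale_le (n + 1) m a.1 b.1
      have h2 := hd.le_scale (n + 1) m a.1 a.2 b.1 b.2
      have h3 : dist a b = d a.1 b.1 := rfl
      have h0 := d.nonneg a.1 b.1
      rw [← hdist] at h1 h2
      rw [h3]
      constructor
      · have h4 : C'⁻¹ ≤ (C * μ⁻¹)⁻¹ := inv_anti₀ (by positivity) hC'3
        calc C'⁻¹ * (r * d a.1 b.1) ≤ (C * μ⁻¹)⁻¹ * (μ ^ n * d a.1 b.1) := by gcongr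
          _ = C⁻¹ * (μ ^ (n + 1) * d a.1 b.1) := by
              rw [mul_inv, inv_inv]
              ring
          _ ≤ C⁻¹ * (C * dist (e a) (e b)) := by gcongr
          _ = dist (e a) (e b) := by field_simp
      · calc dist (e a) (e b) ≤ μ ^ (n + 1) * d a.1 b.1 := h1
          _ ≤ 1 * (r * d a.1 b.1) := by
              rw [one_mul]
              gcongr
          _ ≤ C' * (r * d a.1 b.1) := by gcongr

end IsCoarselySelfSimilar

/-! ### Assembling the factors into the cube. -/

theorem layerSemidistance_isCoarselySelfSimilar {N : ℕ} [NeZero N] (s : Fin N → Ioc (0 : ℝ) 1)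
    (l : ℕ) (hl : LargeEnough (minFactor s) l) (k : Fin N) :
    ∃ C, 0 < C ∧ IsCoarselySelfSimilar (layerSemidistance s l hl k) (scale l) (s k) C := by
  unfold layerSemidistance
  split_ifs with h
  · rw [h]
    exact shortcutSemidistance_isCoarselySelfSimilar hl
  · exact ⟨2, two_pos, snowflake_isCoarselySelfSimilar (s k) (scale_pos l)⟩

end

theorem mainTheorem7 (N : ℕ) [NeZero N] (s : Fin N → Set.Ioc (0 : ℝ) 1)
    (hs : ∑ k, (s k : ℝ) < N) (l : ℕ) (hl : LargeEnough (minFactor s) l) :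
    -- the quotient of the cube is a BPI space of dimension `α = ∑ 1 / s_k`
    IsBPI (CubeQuot s l hl) (∑ k, 1 / (s k : ℝ)) ∧
    -- every factor is a bounded BPI space
    (∀ k, Bornology.IsBounded (Set.univ : Set (FactorQuot s l hl k)) ∧
      IsBPI (FactorQuot s l hl k) (1 / (s k : ℝ))) ∧
    -- the quotient of the cube is, coordinate by coordinate, the `ℓ¹` product of the factors
    ∃ Φ : CubeQuot s l hl ≃ᵢ PiLp 1 (FactorQuot s l hl),
      ∀ (x : Set.Icc (0 : Fin N → ℝ) 1) (k : Fin N),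
        Φ (PseudoMetric.proj _ x) k =
          PseudoMetric.proj _ (⟨x.1 k, x.2.1 k, x.2.2 k⟩ : Set.Icc (0 : ℝ) 1) := by
  have hσ : ∀ k, (0 : ℝ) < s k := fun k => (s k).2.1
  have hα : ∀ k, (0 : ℝ) < 1 / s k := fun k => one_div_pos.2 (hσ k)
  choose C hC hd using layerSemidistance_isCoarselySelfSimilar s l hl
  have hcpt : ∀ k, CompactSpace (FactorQuot s l hl k) := fun k => (hd k).compactSpace (hσ k)
  choose K hK using fun k => (hd k).hasModelCells hl.two_le (hσ k) (hC k)
  obtain ⟨Φ, hΦ⟩ := ((cubeSemidistance s l hl).restrict (Icc 0 1)).exists_isometryEquiv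
    (Y := PiLp 1 (FactorQuot s l hl))
    (F := fun x => WithLp.toLp 1 fun k => PseudoMetric.proj _ ⟨x.1 k, x.2.1 k, x.2.2 k⟩)
    (fun y => by
      choose x hx using fun k =>
        ((layerSemidistance s l hl k).restrict (Icc 0 1)).surjective_proj (y k)
      refine ⟨⟨fun k => x k, fun k => (x k).2.1, fun k => (x k).2.2⟩, ?_⟩
      ext k
      exact hx k)
    (fun x y => by
      rw [PiLp.dist_eq_sum_of_one]
      rfl)
  refine ⟨?_, fun k => ⟨(isCompact_univ (X := FactorQuot s l hl k)).isBounded,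
    (hK k).isBPI (hα k)⟩, Φ, fun x k => by rw [hΦ]⟩
  have hfin : ∀ k, IsFiniteMeasure ((volume.comap ((↑) : Icc (0 : ℝ) 1 → ℝ)).map
      ((layerSemidistance s l hl k).restrict (Icc 0 1)).proj) := by
    intro k
    have : IsFiniteMeasure (volume.comap ((↑) : Icc (0 : ℝ) 1 → ℝ)) := by
      refine ⟨?_⟩
      rw [(MeasurableEmbedding.subtype_coe measurableSet_Icc).comap_apply, image_univ, Subtype.range_coe, Real.volume_Icc]
      exact ENNReal.ofReal_lt_top
    infer_instance
  -- The product criterion needs one constant for all factors; the sum of their constants serves.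
  obtain ⟨C', hC'⟩ := HasModelCells.pi hα fun k =>
    (hK k).mono (Finset.single_le_sum (f := K) (fun k _ => zero_le_one.trans (hK k).one_le)
      (Finset.mem_univ k))
  have hcpt' : CompactSpace (PiLp 1 (FactorQuot s l hl)) :=
    (PiLp.homeomorph 1 (FactorQuot s l hl)).symm.compactSpace
  exact IsBPI.of_isometryEquiv Φ (hC'.isBPI (Finset.sum_pos (fun k _ => hα k) Finset.univ_nonempty))
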